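/- **Setting.** Write $\mathbb R^+=[0,\infty)$ and $|\cdot|$ for the Euclidean norm. $K^+$ is the class of continuous functions $\mathbb R^+\to(0,\infty)$. $KL$ is the class of continuous $\sigma:\mathbb R^+\times\mathbb R^+\to\mathbb R^+$ such that $\sigma(\cdot,t)$ is strictly increasing with $\sigma(0,t)=0$ for each $t\ge 0$, and $\sigma(s,\cdot)$ is non-increasing with $\lim_{t\to\infty}\sigma(s,t)=0$ for each $s\ge 0$. A function $F(t,x)$ is *locally Lipschitz in $x$* if for every bounded interval $I\subset\mathbb R^+$ and every compact set $S$ there is $L\ge 0$ with $|F(t,x)-F(t,x')|\le L|x-x'|$ for all $t\in I$, $x,x'\in S$. Consider the system $$\dot x(t)=f(t,x(t),d(t)),\qquad y(t)=h(t,x(t)),\qquad x\in\mathbb R^n,\ y\in\mathbb R^k,\ d(t)\in D,\tag{1.4}$$ where $D\subset\mathbb R^q$ is compact, $f:\mathbb R^+\times\mathbb R^n\times D\to\mathbb R^n$ and $h:\mathbb R^+\times\mathbb R^n\to\mathbb R^k$ are continuous, $f(t,0,d)=0$ and $h(t,0)=0$ for all $t\ge0$, $d\in D$, and $f$ is locally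 Lipschitz in $x$ uniformly in $d\in D$ (the constant $L$ serves all $d\in D$). Let $M_D$ be the set of measurable $d:\mathbb R^+\to D$. A system with disturbances in $M_D$ is *robustly forward complete (RFC)* if for all $t_0\ge0$, all initial states $x_0$ at time $t_0$ and all $d\in M_D$ the (Carathéodory) solution exists on $[t_0,\infty)$, and for all $T,r\ge 0$ $$\sup\{|x(t_0+s)| : |x_0|\le r,\ t_0\in[0,T],\ s\in[0,T],\ d\in M_D\}<\infty .$$ Assume that (1.4) is RFC. **Observability and detectability.** An *output family* consists of integers $p\ge0$ and $m_j\ge0$ ($1\le j\le p$) and continuous functions $g_j,a_j,\varphi_{i,j}:\mathbb R^+\times\mathbb R^k\to\mathbb R$ ($1\le j\le p$, $1\le i\le m_j$) with $g_j(t,0)=\varphi_{i,j}(t,0)=0$ for all $t\ge 0$, $\inf a_j>0$, and $a_j(t,h(t,x))$ and $\varphi_{i,j}(t,h(t,x))$ locally Lipschitz in $x$, such that the functions defined recursively by $y_{0,j}(t,x)=g_j(t,h(t,x))$ and $$y_{i,j}(t,x)=\frac1{a_j(t,h(t,x))}\Big\{\frac{\partial y_{i-1,j}}{\partial t}(t,x)+\frac{\partial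 y_{i-1,j}}{\partial x}(t,x)f(t,x,d)+\varphi_{i,j}(t,h(t,x))\Big\},\qquad 1\le i\le m_j,$$ are all independent of $d\in D$ and of class $C^1(\mathbb R^+\times\mathbb R^n;\mathbb R)$. Put $m=\sum_j m_j$ and $\mathcal Dy(t,x)=(y_{i,j}(t,x))_{1\le j\le p,\,1\le i\le m_j}\in\mathbb R^m$. Let $\theta:\mathbb R^+\times\mathbb R^n\to\mathbb R^l$ be continuous with $\theta(t,0)=0$ for all $t\ge 0$. It is *robustly completely observable* with respect to (1.4) if there are an output family and a continuous $\Psi:\mathbb R^+\times\mathbb R^k\times\mathbb R^m\to\mathbb R^l$ with $\Psi(t,0,0)=0$ for all $t\ge0$ such that $\theta(t,x)=\Psi(t,h(t,x),\mathcal Dy(t,x))$ for all $(t,x)\in\mathbb R^+\times\mathbb R^n$. It is *robustly completely detectable* with respect to (1.4) if there are an output family, such a $\Psi$, and $\sigma\in KL$, $\beta\in K^+$ such that for all $t_0\ge0$, $x_0\in\mathbb R^n$ and $d\in M_D$ the solution of (1.4) with $x(t_0)=x_0$ satisfies $$|\theta(t,x(t))-\Psi(t,h(t,x(t)),\mathcal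 Dy(t,x(t)))|\le\sigma(\beta(t_0)|x_0|,t-t_0)\qquad\text{for all } t\ge t_0 .$$ **Estimators.** Let $\phi\in K^+$. A *$\phi$-estimator* for $\theta$ with respect to (1.4) is a system $$\dot z(t)=\kappa(t,z(t),y(t)),\qquad\bar\theta(t)=\Psi(t,y(t),z(t)),\qquad z\in\mathbb R^m\ \text{(for some integer } m\ge 0),$$ with $\kappa:\mathbb R^+\times\mathbb R^m\times\mathbb R^k\to\mathbb R^m$ and $\Psi:\mathbb R^+\times\mathbb R^k\times\mathbb R^m\to\mathbb R^l$ continuous, $\kappa(t,0,0)=0$ and $\Psi(t,0,0)=0$ for all $t\ge 0$, and $\kappa(t,z,h(t,x))$ locally Lipschitz in $(x,z)$, such that the combined system with state $(x,z)$ is RFC and there are $\sigma\in KL$, $\beta\in K^+$ such that for all $t_0\ge0$, $(x_0,z_0)\in\mathbb R^n\times\mathbb R^m$ and $d\in M_D$ the solution of the combined system with $(x(t_0),z(t_0))=(x_0,z_0)$ satisfies $$\phi(t)\,|\bar\theta(t)-\theta(t,x(t))|\le\sigma(\beta(t_0)|(x_0,z_0)|,\,t-t_0)\qquad\text{for all }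 t\ge t_0 .$$ An *estimator* is a $\phi$-estimator for $\phi\equiv1$. **Theorem 3.1.** If $\theta$ is robustly completely observable with respect to (1.4), then for every $\phi\in K^+$ there exists a $\phi$-estimator for $\theta$ with respect to (1.4). If $\theta$ is robustly completely detectable with respect to (1.4), then there exists an estimator for $\theta$ with respect to (1.4). -/

import Mathlib

open Set Filter Topology MeasureTheory
open scoped NNReal

namespace Estimator

/-- `ℝⁿ` with its Euclidean norm. -/
abbrev E (n : ℕ) : Type := EuclideanSpace ℝ (Fin n)

/-! ### Comparison functions.  Functions on `ℝ⁺ = [0, ∞)` are total functions on `ℝ` of which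
only the values at arguments `≥ 0` matter. -/

/-- Class `K⁺`: continuous positive functions on `[0, ∞)`. -/
structure KPlus (φ : ℝ → ℝ) : Prop where
  cont : ContinuousOn φ (Ici 0)
  pos : ∀ t, 0 ≤ t → 0 < φ t

/-- Class `KL`: continuous `σ(s, t)` on `[0, ∞) × [0, ∞)`, of class `K` in `s` (strictly increasing,
zero at zero), non-increasing in `t` and tending to `0` as `t → ∞`. -/
structure KL (σ : ℝ → ℝ → ℝ) : Prop where
  cont : ContinuousOn (fun p : ℝ × ℝ => σ p.1 p.2) (Ici 0 ×ˢ Ici 0)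
  strictMono : ∀ t, 0 ≤ t → StrictMonoOn (fun s => σ s t) (Ici 0)
  zero : ∀ t, 0 ≤ t → σ 0 t = 0
  antitone : ∀ s, 0 ≤ s → AntitoneOn (σ s) (Ici 0)
  tendsto : ∀ s, 0 ≤ s → Tendsto (σ s) atTop (𝓝 0)

/-! ### Continuity and local Lipschitz continuity on `ℝ⁺ × X` -/

/-- `F ∈ C⁰(ℝ⁺ × X; Y)`. -/
def ContState {X Y : Type*} [TopologicalSpace X] [TopologicalSpace Y] (F : ℝ → X → Y) : Prop :=
  ContinuousOn (fun p : ℝ × X => F p.1 p.2) (Ici 0 ×ˢ univ)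

/-- `F(t, x)` is locally Lipschitz with respect to `x`: on every bounded time interval and every
compact set of states there is a Lipschitz constant that serves all times of the interval. -/
def LocLipState {X Y : Type*} [PseudoEMetricSpace X] [PseudoEMetricSpace Y]
    (F : ℝ → X → Y) : Prop :=
  ∀ (T : ℝ) (S : Set X), IsCompact S → ∃ L : ℝ≥0, ∀ t ∈ Icc 0 T, LipschitzOnWith L (F t) S

/-! ### Systems with disturbances, solutions, robust forward completeness -/

/-- The measurable disturbances `d : ℝ⁺ → D`. -/
def Disturbances {U : Type*} [MeasurableSpace U] (D : Set U) : Set (ℝ → U) :=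
  {d | Measurable d ∧ ∀ t, 0 ≤ t → d t ∈ D}

/-- `x` is a (Carathéodory) solution on `[t₀, ∞)` of `ẋ(t) = f(t, x(t), d(t))`, `x(t₀) = x₀`. -/
structure IsSolution {X U : Type*} [NormedAddCommGroup X] [NormedSpace ℝ X]
    (f : ℝ → X → U → X) (d : ℝ → U) (t₀ : ℝ) (x₀ : X) (x : ℝ → X) : Prop where
  cont : ContinuousOn x (Ici t₀)
  integrable : ∀ t, t₀ ≤ t → IntervalIntegrable (fun s => f s (x s) (d s)) volume t₀ t
  eq : ∀ t, t₀ ≤ t → x t = x₀ + ∫ s in t₀..t, f s (x s) (d s)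

/-- Robust forward completeness: all solutions exist for all later times, and they are bounded
uniformly over bounded initial data, bounded times and all disturbances. -/
structure RFC {X U : Type*} [NormedAddCommGroup X] [NormedSpace ℝ X] [MeasurableSpace U]
    (D : Set U) (f : ℝ → X → U → X) : Prop where
  exists_solution : ∀ t₀, 0 ≤ t₀ → ∀ x₀ : X, ∀ d ∈ Disturbances D, ∃ x, IsSolution f d t₀ x₀ x
  bounded : ∀ T, 0 ≤ T → ∀ r, 0 ≤ r → ∃ C : ℝ, ∀ t₀ ∈ Icc 0 T, ∀ x₀ : X, ‖x₀‖ ≤ r →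
    ∀ d ∈ Disturbances D, ∀ x, IsSolution f d t₀ x₀ x → ∀ s ∈ Icc 0 T, ‖x (t₀ + s)‖ ≤ C

/-- The standing assumptions on `ẋ = f(t, x, d)`, `y = h(t, x)`, `d ∈ D`. -/
structure IsSystem {n k q : ℕ} (D : Set (E q)) (f : ℝ → E n → E q → E n) (h : ℝ → E n → E k) :
    Prop where
  compact : IsCompact D
  f_cont : ContinuousOn (fun p : ℝ × E n × E q => f p.1 p.2.1 p.2.2) (Ici 0 ×ˢ univ ×ˢ D)
  h_cont : ContState h
  f_zero : ∀ t, 0 ≤ t → ∀ d ∈ D, f t 0 d = 0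
  h_zero : ∀ t, 0 ≤ t → h t 0 = 0
  f_lip : ∀ (T : ℝ) (S : Set (E n)), IsCompact S →
    ∃ L : ℝ≥0, ∀ t ∈ Icc 0 T, ∀ d ∈ D, LipschitzOnWith L (fun x => f t x d) S

/-! ### Observability and detectability -/

/-- A choice of `p`, `m_j`, `g_j`, `a_j`, `φ_{i,j}` (here `inj j i`), together with the functions
`y_{i,j}` (here `y j i`) for `0 ≤ i ≤ m_j` that they determine recursively, all of them `C¹` and
independent of `d ∈ D`.  Values of `inj j i` and `y j i` at other indices `i` play no role. -/
structure OutputFamily {n k q : ℕ} (D : Set (E q)) (f : ℝ → E n → E q → E n)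
    (h : ℝ → E n → E k) where
  p : ℕ
  m : Fin p → ℕ
  g : Fin p → ℝ → E k → ℝ
  a : Fin p → ℝ → E k → ℝ
  inj : Fin p → ℕ → ℝ → E k → ℝ
  y : Fin p → ℕ → ℝ → E n → ℝ
  g_cont : ∀ j, ContState (g j)
  g_zero : ∀ j t, 0 ≤ t → g j t 0 = 0
  a_cont : ∀ j, ContState (a j)
  a_pos : ∀ j, ∃ c : ℝ, 0 < c ∧ ∀ t, 0 ≤ t → ∀ v, c ≤ a j t v
  a_lip : ∀ j, LocLipState (fun t x => a j t (h t x))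
  inj_cont : ∀ j i, 1 ≤ i → i ≤ m j → ContState (inj j i)
  inj_zero : ∀ j i, 1 ≤ i → i ≤ m j → ∀ t, 0 ≤ t → inj j i t 0 = 0
  inj_lip : ∀ j i, 1 ≤ i → i ≤ m j → LocLipState (fun t x => inj j i t (h t x))
  /-- `y_{i,j}` is `C¹` on `ℝ⁺ × ℝⁿ` (one-sided in time at `t = 0`). -/
  y_smooth : ∀ j i, i ≤ m j →
    ContDiffOn ℝ 1 (fun u : ℝ × E n => y j i u.1 u.2) (Ici 0 ×ˢ univ)
  y_zero : ∀ j t, 0 ≤ t → ∀ x, y j 0 t x = g j t (h t x)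
  /-- The derivative of `y_{i,j}` at `(t, x)` in the direction `(1, f(t, x, d))` is
  `∂y_{i,j}/∂t + (∂y_{i,j}/∂x) f(t, x, d)`. -/
  y_succ : ∀ j i, i < m j → ∀ t, 0 ≤ t → ∀ x, ∀ d ∈ D,
    y j (i + 1) t x = 1 / a j t (h t x) *
      (fderivWithin ℝ (fun u : ℝ × E n => y j i u.1 u.2) (Ici 0 ×ˢ univ) (t, x) (1, f t x d)
        + inj j (i + 1) t (h t x))

/-- `ℝᵐ` with `m = m₁ + ⋯ + m_p`, its coordinates indexed by the pairs `(j, i)`. -/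
abbrev OutputFamily.Space {n k q : ℕ} {D : Set (E q)} {f : ℝ → E n → E q → E n}
    {h : ℝ → E n → E k} (F : OutputFamily D f h) : Type :=
  EuclideanSpace ℝ (Σ j : Fin F.p, Fin (F.m j))

/-- `𝒟y(t, x)`, the vector of all `y_{i,j}(t, x)` with `1 ≤ i ≤ m_j`. -/
noncomputable def OutputFamily.Dy {n k q : ℕ} {D : Set (E q)} {f : ℝ → E n → E q → E n}
    {h : ℝ → E n → E k} (F : OutputFamily D f h) (t : ℝ) (x : E n) : F.Space :=
  WithLp.toLp 2 (fun c => F.y c.1 ((c.2 : ℕ) + 1) t x)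

/-- `Ψ ∈ C⁰(ℝ⁺ × Y × Z; W)` with `Ψ(t, 0, 0) = 0` for `t ≥ 0`. -/
structure ContZero {Y Z W : Type*} [TopologicalSpace Y] [TopologicalSpace Z] [TopologicalSpace W]
    [Zero Y] [Zero Z] [Zero W] (Ψ : ℝ → Y → Z → W) : Prop where
  cont : ContinuousOn (fun p : ℝ × Y × Z => Ψ p.1 p.2.1 p.2.2) (Ici 0 ×ˢ univ)
  zero : ∀ t, 0 ≤ t → Ψ t 0 0 = 0

/-- `θ` is robustly completely observable. -/
def RobustlyCompletelyObservable {n k q l : ℕ} (D : Set (E q)) (f : ℝ → E n → E q → E n)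
    (h : ℝ → E n → E k) (θ : ℝ → E n → E l) : Prop :=
  ∃ (F : OutputFamily D f h) (Ψ : ℝ → E k → F.Space → E l), ContZero Ψ ∧
    ∀ t, 0 ≤ t → ∀ x, θ t x = Ψ t (h t x) (F.Dy t x)

/-- `θ` is robustly completely detectable. -/
def RobustlyCompletelyDetectable {n k q l : ℕ} (D : Set (E q)) (f : ℝ → E n → E q → E n)
    (h : ℝ → E n → E k) (θ : ℝ → E n → E l) : Prop :=
  ∃ (F : OutputFamily D f h) (Ψ : ℝ → E k → F.Space → E l), ContZero Ψ ∧
    ∃ (σ : ℝ → ℝ → ℝ) (β : ℝ → ℝ), KL σ ∧ KPlus β ∧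
      ∀ t₀, 0 ≤ t₀ → ∀ x₀ : E n, ∀ d ∈ Disturbances D, ∀ x, IsSolution f d t₀ x₀ x →
        ∀ t, t₀ ≤ t →
          ‖θ t (x t) - Ψ t (h t (x t)) (F.Dy t (x t))‖ ≤ σ (β t₀ * ‖x₀‖) (t - t₀)

/-! ### Estimators -/

/-- The right-hand side of the interconnection `ẋ = f(t, x, d)`, `ż = κ(t, z, h(t, x))`. -/
def interconnection {n k q m : ℕ} (f : ℝ → E n → E q → E n) (h : ℝ → E n → E k)
    (κ : ℝ → E m → E k → E m) (t : ℝ) (w : E n × E m) (d : E q) : E n × E m :=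
  (f t w.1 d, κ t w.2 (h t w.1))

/-- `ż = κ(t, z, y)`, `θ̄ = Ψ(t, y, z)` is a `φ`-estimator for `θ`. The norm on `E n × E m` is used
only in `lip` and `rfc`, which do not depend on the choice among equivalent norms; the estimate uses
the Euclidean norm of `(x₀, z₀)`. -/
structure IsEstimator {n k q l m : ℕ} (D : Set (E q)) (f : ℝ → E n → E q → E n)
    (h : ℝ → E n → E k) (θ : ℝ → E n → E l) (φ : ℝ → ℝ)
    (κ : ℝ → E m → E k → E m) (Ψ : ℝ → E k → E m → E l) : Prop where
  κ_contZero : ContZero κ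
  lip : LocLipState (fun t (w : E n × E m) => κ t w.2 (h t w.1))
  Ψ_contZero : ContZero Ψ
  rfc : RFC D (interconnection f h κ)
  estimate : ∃ (σ : ℝ → ℝ → ℝ) (β : ℝ → ℝ), KL σ ∧ KPlus β ∧
    ∀ t₀, 0 ≤ t₀ → ∀ (x₀ : E n) (z₀ : E m), ∀ d ∈ Disturbances D, ∀ w : ℝ → E n × E m,
      IsSolution (interconnection f h κ) d t₀ (x₀, z₀) w → ∀ t, t₀ ≤ t →
        φ t * ‖Ψ t (h t (w t).1) (w t).2 - θ t (w t).1‖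
          ≤ σ (β t₀ * Real.sqrt (‖x₀‖ ^ 2 + ‖z₀‖ ^ 2)) (t - t₀)

/-- There is a `φ`-estimator for `θ`, of some finite dimension `m`. -/
def HasEstimator {n k q l : ℕ} (D : Set (E q)) (f : ℝ → E n → E q → E n)
    (h : ℝ → E n → E k) (θ : ℝ → E n → E l) (φ : ℝ → ℝ) : Prop :=
  ∃ (m : ℕ) (κ : ℝ → E m → E k → E m) (Ψ : ℝ → E k → E m → E l), IsEstimator D f h θ φ κ Ψ

end Estimator

/-!
The estimator is a cascade of scalar high-gain filters. Fix a chain `y₀, …, yₘ` of the output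
family. Along a solution `ẏᵢ = a yᵢ₊₁ - φᵢ₊₁` for almost every time, where `y₀`, `a ≥ c > 0` and
`φᵢ₊₁` are functions of time and of the measured output. With `ŷ₀ = y₀` put
`żᵢ = a ŷᵢ₊₁ - φᵢ₊₁` and `ŷᵢ₊₁ = sᵢ(t)⁻² (ŷᵢ - zᵢ)` for a positive `C¹` function `sᵢ` of time
(`OutputFamily.observer`, `OutputFamily.estimate`). The rescaled error
`u = (yᵢ - zᵢ) / sᵢ³ - yᵢ₊₁ / sᵢ` satisfies
`d(u²)/dt ≤ - (a / (2 sᵢ²)) (u² - 1/4)` as soon as `sᵢ`, `ṡᵢ` are small compared with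
`1 / |yᵢ₊₁|`, `1 / |ẏᵢ₊₁|`, and `|ŷᵢ - yᵢ| ≤ sᵢ³ / 8`. So eventually `|u| ≤ 1`, and then
`|ŷᵢ₊₁ - yᵢ₊₁| ≤ 2 sᵢ` (`filter_tracking`). Taking `sᵢ ≤ sᵢ₊₁³ / 16`, that is, filters that are
much faster at the low levels, propagates the estimate along the chain
(`OutputFamily.uniformlyEventually_abs_estimate_sub_le`).

No a priori knowledge of the trajectory is needed for the choice of `sᵢ`. By robust forward
completeness there are numbers `B N` with `|x(t)| ≤ B ⌈t⌉` for every solution that starts at a time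
`t₀ ≤ t` with `|x₀| ≤ t`, hence for every solution, after a time that is uniform over bounded
`t₀` and `x₀`. A function of `t` alone which is small compared with the reciprocals of all relevant
bounds on `[0, N] × {|x| ≤ B N}` is therefore eventually small enough along every solution, and it
can at the same time be made smaller than a modulus of continuity of `φ Ψ`
(`OutputFamily.exists_gains`). This gives convergence, uniform over bounded initial data; that any
weight `φ` is allowed in the observable case costs nothing.

The observer is affine in `z` and triangular, so its solutions are given by variation of constants,
and Grönwall's inequality bounds them: the interconnection is robustly forward complete
(`OutputFamily.rfc_interconnection_observer`). Finally, uniform convergence together with robust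
forward completeness and Lipschitz continuity at the zero solution yields a `KL` estimate
(`RFC.exists_KL_estimate`); the function `σ` is a supremum of bump functions placed at the data
(`exists_KL_majorant`), and `β` absorbs the dependence on the initial time
(`exists_KL_KPlus_majorant`).
-/

open Set Filter Topology MeasureTheory
open scoped NNReal

namespace Estimator

/-! ### Small smooth functions of time -/

theorem exists_antitone_le_seq (ν : ℕ → ℝ) (hν : ∀ N, 0 < ν N) :
    ∃ μ : ℝ → ℝ, Antitone μ ∧ (∀ t, 0 < μ t) ∧ ∀ t, μ t ≤ ν ⌈t⌉₊ := by
  refine ⟨fun t => (Finset.range (⌈t⌉₊ + 1)).inf' ⟨0, by simp⟩ ν, ?_, ?_, ?_⟩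
  · intro s t hst
    refine Finset.inf'_mono ν ?_ _
    exact Finset.range_mono (by gcongr)
  · intro t
    exact (Finset.lt_inf'_iff _).2 fun i _ => hν i
  · intro t
    exact Finset.inf'_le _ (by simp)

/-- The average of `μ` over `[t, t + 1]`. For antitone `μ` it lies between `μ (t + 1)` and `μ t`
and is one degree smoother than `μ`. -/
noncomputable def windowAverage (μ : ℝ → ℝ) (t : ℝ) : ℝ := ∫ x in t..t + 1, μ x

theorem windowAverage_le {μ : ℝ → ℝ} (hμ : Antitone μ) (t : ℝ) : windowAverage μ t ≤ μ t := by
  have h := intervalIntegral.integral_mono_on (μ := volume) (a := t) (b := t + 1) (f := μ)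
    (g := fun _ => μ t) (by linarith) hμ.intervalIntegrable (by simp) (fun x hx => hμ hx.1)
  simpa [windowAverage] using h

theorem le_windowAverage {μ : ℝ → ℝ} (hμ : Antitone μ) (t : ℝ) :
    μ (t + 1) ≤ windowAverage μ t := by
  have h := intervalIntegral.integral_mono_on (μ := volume) (a := t) (b := t + 1) (g := μ)
    (f := fun _ => μ (t + 1)) (by linarith) (by simp) hμ.intervalIntegrable (fun x hx => hμ hx.2)
  simpa [windowAverage] using h

theorem antitone_windowAverage {μ : ℝ → ℝ} (hμ : Antitone μ) : Antitone (windowAverage μ) := by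
  have key : ∀ t, windowAverage μ t = ∫ x in (0 : ℝ)..1, μ (x + t) := by
    intro t
    rw [intervalIntegral.integral_comp_add_right]
    simp [windowAverage, add_comm]
  intro s t hst
  rw [key, key]
  have hi : ∀ r, IntervalIntegrable (fun x => μ (x + r)) volume 0 1 := fun r =>
    Antitone.intervalIntegrable (fun x y hxy => hμ (by linarith))
  exact intervalIntegral.integral_mono_on (by norm_num) (hi t) (hi s)
    (fun x _ => hμ (by linarith))

theorem windowAverage_eq {μ : ℝ → ℝ} (hμ : Antitone μ) :
    windowAverage μ = fun t => (∫ x in (0 : ℝ)..(t + 1), μ x) - ∫ x in (0 : ℝ)..t, μ x := by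
  funext t
  rw [intervalIntegral.integral_interval_sub_left hμ.intervalIntegrable hμ.intervalIntegrable]
  rfl

theorem continuous_windowAverage {μ : ℝ → ℝ} (hμ : Antitone μ) :
    Continuous (windowAverage μ) := by
  rw [windowAverage_eq hμ]
  have h := intervalIntegral.continuous_primitive (μ := volume) (f := μ)
    (fun a b => hμ.intervalIntegrable) 0
  exact (h.comp (continuous_id.add continuous_const)).sub h

theorem hasDerivAt_windowAverage {μ : ℝ → ℝ} (hμ : Antitone μ) (hc : Continuous μ) (t : ℝ) :
    HasDerivAt (windowAverage μ) (μ (t + 1) - μ t) t := by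
  rw [windowAverage_eq hμ]
  have h : ∀ r, HasDerivAt (fun r => ∫ x in (0 : ℝ)..r, μ x) (μ r) r := fun r =>
    (hc.integral_hasStrictDerivAt 0 r).hasDerivAt
  exact ((h (t + 1)).comp_add_const t 1).sub (h t)

/-- Averaging twice over unit windows makes a positive antitone function `C¹` without enlarging it,
and keeps the derivative below it as well. -/
theorem exists_contDiff_antitone_le (μ : ℝ → ℝ) (hμ : Antitone μ) (hpos : ∀ t, 0 < μ t) :
    ∃ s : ℝ → ℝ, ContDiff ℝ 1 s ∧ Antitone s ∧ (∀ t, 0 < s t) ∧ (∀ t, s t ≤ μ t) ∧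
      ∀ t, |deriv s t| ≤ μ t := by
  have h1 := antitone_windowAverage hμ
  have c1 := continuous_windowAverage hμ
  have p1 : ∀ t, 0 < windowAverage μ t := fun t => (hpos _).trans_le (le_windowAverage hμ t)
  have hd := hasDerivAt_windowAverage h1 c1
  refine ⟨windowAverage (windowAverage μ), ?_, antitone_windowAverage h1,
    fun t => (p1 _).trans_le (le_windowAverage h1 t),
    fun t => (windowAverage_le h1 t).trans (windowAverage_le hμ t), fun t => ?_⟩
  · rw [contDiff_one_iff_deriv]
    refine ⟨fun t => (hd t).differentiableAt, ?_⟩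
    rw [show deriv (windowAverage (windowAverage μ)) = _ from funext fun t => (hd t).deriv]
    fun_prop
  · rw [(hd t).deriv, abs_le]
    have := windowAverage_le hμ t
    have := p1 t
    have := p1 (t + 1)
    have := h1 (show t ≤ t + 1 by linarith)
    constructor <;> linarith

/-- Time scales for the levels of a cascade, each one much smaller than the cube of the preceding
one and all below `μ` together with their derivatives. -/
theorem exists_gain_hierarchy (μ : ℝ → ℝ) (hμ : Antitone μ) (hpos : ∀ t, 0 < μ t) :
    ∃ S : ℕ → ℝ → ℝ, ∀ k, ContDiff ℝ 1 (S k) ∧ (∀ t, 0 < S k t) ∧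
      (∀ t, S k t ≤ μ t) ∧ (∀ t, |deriv (S k) t| ≤ μ t) ∧ ∀ t, S (k + 1) t ≤ S k t ^ 3 / 16 := by
  let Good : (ℝ → ℝ) → Prop := fun s => ContDiff ℝ 1 s ∧ Antitone s ∧ (∀ t, 0 < s t) ∧
    (∀ t, s t ≤ μ t) ∧ ∀ t, |deriv s t| ≤ μ t
  have h0 : ∃ s, Good s := exists_contDiff_antitone_le μ hμ hpos
  have step : ∀ s : {s // Good s}, ∃ s' : {s // Good s}, ∀ t, s'.1 t ≤ s.1 t ^ 3 / 16 := by
    rintro ⟨s, -, hs, sp, -, -⟩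
    obtain ⟨s', h1, h2, h3, h4, h5⟩ := exists_contDiff_antitone_le
      (fun t => min (μ t) (s t ^ 3 / 16)) (hμ.min (fun a b hab => by
        have := hs hab
        have := (sp b).le
        gcongr)) (fun t => lt_min (hpos t) (by have := sp t; positivity))
    exact ⟨⟨s', h1, h2, h3, fun t => (h4 t).trans (min_le_left _ _),
      fun t => (h5 t).trans (min_le_left _ _)⟩, fun t => (h4 t).trans (min_le_right _ _)⟩
  choose G hG using step
  obtain ⟨s0, hs0⟩ := h0
  refine ⟨fun k => (Nat.rec ⟨s0, hs0⟩ (fun _ s => G s) k : {s // Good s}).1, fun k => ?_⟩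
  obtain ⟨h1, -, h3, h4, h5⟩ := (Nat.rec ⟨s0, hs0⟩ (fun _ s => G s) k : {s // Good s}).2
  exact ⟨h1, h3, h4, h5, fun t => hG _ t⟩

/-! ### Tracking by a scalar high-gain filter -/

/-- The decay of `u²` for the rescaled error `u` of `filter_tracking`. The factor of `2 * u` is the
derivative of `u`. -/
theorem filter_energy_decay {c : ℝ} (hc : 0 < c) {s a ε Y Y' u : ℝ} {s' : ℝ} (hs : 0 < s)
    (hs1 : s ≤ 1) (ha : c ≤ a) (hε : |ε| ≤ s ^ 3 / 8) (h1 : |s * Y'| ≤ c / 32)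
    (h2 : |s' * Y| ≤ c / 32) (h3 : |s'| ≤ c / 32) :
    2 * u * (-(a / s ^ 2) * ((1 + 3 * s' * s / a) * u +
      (ε / s ^ 3 + 2 * (s' * Y) / a + s * Y' / a))) ≤ -(a / s ^ 2 / 2) * (u ^ 2 - 1 / 4) := by
  have ha0 : 0 < a := hc.trans_le ha
  have hA : 0 < a / s ^ 2 := by positivity
  have e1 : |3 * s' * s / a| ≤ 1 / 2 := by
    rw [abs_div, abs_mul, abs_mul, abs_of_pos ha0, abs_of_pos hs, div_le_iff₀ ha0]
    have : |s'| * s ≤ c / 32 := by nlinarith [abs_nonneg s']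
    norm_num
    nlinarith
  have e2 : |ε / s ^ 3| ≤ 1 / 8 := by
    rw [abs_div, abs_of_pos (by positivity : 0 < s ^ 3), div_le_iff₀ (by positivity)]
    linarith
  have e3 : |2 * (s' * Y) / a| ≤ 1 / 16 := by
    rw [abs_div, abs_mul, abs_of_pos ha0, div_le_iff₀ ha0, abs_two]
    linarith
  have e4 : |s * Y' / a| ≤ 1 / 32 := by
    rw [abs_div, abs_of_pos ha0, div_le_iff₀ ha0]
    linarith
  generalize 3 * s' * s / a = α at *
  have e5 : |ε / s ^ 3 + 2 * (s' * Y) / a + s * Y' / a| ≤ 1 / 4 := by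
    rw [abs_le] at *
    constructor <;> linarith
  generalize ε / s ^ 3 + 2 * (s' * Y) / a + s * Y' / a = b at *
  generalize a / s ^ 2 = A at *
  have e6 : (u ^ 2 - 1 / 4) / 4 ≤ (1 + α) * u ^ 2 + b * u := by
    have h7 : -(1 / 4 * |u|) ≤ b * u := by
      have := neg_abs_le (b * u)
      rw [abs_mul] at this
      nlinarith [abs_nonneg u]
    have h8 : 1 / 2 * u ^ 2 ≤ (1 + α) * u ^ 2 := by
      have := (abs_le.1 e1).1
      gcongr
      linarith
    nlinarith [sq_nonneg (|u| - 1 / 2), sq_abs u]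
  nlinarith

/-- A signal `Y` with `ė = a (Y - s⁻² (e + ε))` is recovered from `e` up to `2 s` by the
high-gain expression `s⁻² (e + ε)`, when `s` is small compared with `Y` and its derivative `Y'` and
the perturbation `ε` is of order `s³`. The bound holds at `t` once the initial value `K` of the
rescaled error has been damped out over `[τ, t]`. The signal need only be absolutely continuous,
since the highest `y_{i,j}` is no better than that along a solution with a measurable
disturbance. -/
theorem filter_tracking {c τ t K : ℝ} (hc : 0 < c) {s a e ε Y Y' : ℝ → ℝ} (hτt : τ ≤ t)
    (hs : ContDiff ℝ 1 s) (spos : ∀ r, 0 < s r) (hs1 : ∀ r ∈ Icc τ t, s r ≤ 1)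
    (ha : ContinuousOn a (Icc τ t)) (hac : ∀ r ∈ Icc τ t, c ≤ a r)
    (hY : AbsolutelyContinuousOnInterval Y τ t)
    (hY' : ∀ᵐ r, r ∈ Icc τ t → HasDerivAt Y (Y' r) r)
    (he : AbsolutelyContinuousOnInterval e τ t)
    (he' : ∀ᵐ r, r ∈ Icc τ t → HasDerivAt e (a r * (Y r - (s r)⁻¹ ^ 2 * (e r + ε r))) r)
    (hε : ∀ r ∈ Icc τ t, |ε r| ≤ s r ^ 3 / 8)
    (h1 : ∀ᵐ r, r ∈ Icc τ t → |s r * Y' r| ≤ c / 32)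
    (h2 : ∀ r ∈ Icc τ t, |deriv s r * Y r| ≤ c / 32)
    (h3 : ∀ r ∈ Icc τ t, |deriv s r| ≤ c / 32)
    (hK : |e τ * (s τ)⁻¹ ^ 3 - Y τ * (s τ)⁻¹| ≤ K)
    (hKt : K ^ 2 * Real.exp (-(c / 2 * (t - τ))) ≤ 3 / 4) :
    |(s t)⁻¹ ^ 2 * (e t + ε t) - Y t| ≤ 2 * s t := by
  have hsc : Continuous s := hs.continuous
  have hs0 : ∀ r, s r ≠ 0 := fun r => (spos r).ne'
  let A : ℝ → ℝ := IccExtend hτt ((Icc τ t).domRestrict fun r => a r / s r ^ 2 / 2)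
  have hAc : Continuous A := by
    refine Continuous.Icc_extend' (ContinuousOn.domRestrict ?_)
    exact (ha.div (by fun_prop) (fun r _ => pow_ne_zero _ (hs0 r))).div_const _
  have hAe : ∀ r ∈ Icc τ t, A r = a r / s r ^ 2 / 2 := fun r hr => IccExtend_of_mem _ _ hr
  let Λ : ℝ → ℝ := fun r => ∫ x in τ..r, A x
  have hΛ : ∀ r, HasDerivAt Λ (A r) r := fun r => (hAc.integral_hasStrictDerivAt τ r).hasDerivAt
  have hE : ∀ r, HasDerivAt (fun r => Real.exp (Λ r)) (Real.exp (Λ r) * A r) r :=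
    fun r => (hΛ r).exp
  have hEC : ContDiff ℝ 1 fun r => Real.exp (Λ r) := by
    rw [contDiff_one_iff_deriv]
    refine ⟨fun r => (hE r).differentiableAt, ?_⟩
    rw [show deriv (fun r => Real.exp (Λ r)) = _ from funext fun t => (hE t).deriv]
    have : Continuous Λ := continuous_iff_continuousAt.2 fun r => (hΛ r).continuousAt
    fun_prop
  have hinv : ContDiff ℝ 1 fun r => (s r)⁻¹ := hs.inv hs0
  have hinvA : AbsolutelyContinuousOnInterval (fun r => (s r)⁻¹) τ t :=
    hinv.contDiffOn.absolutelyContinuousOnInterval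
  have hinvA3 : AbsolutelyContinuousOnInterval (fun r => (s r)⁻¹ ^ 3) τ t :=
    (hinv.pow 3).contDiffOn.absolutelyContinuousOnInterval
  -- In equilibrium `e ≈ s² Y`; the deviation from it is measured in units of `s³`.
  let u : ℝ → ℝ := fun r => e r * (s r)⁻¹ ^ 3 - Y r * (s r)⁻¹
  have hu : AbsolutelyContinuousOnInterval u τ t := (he.fun_mul hinvA3).fun_sub (hY.fun_mul hinvA)
  -- `W` is antitone, as an absolutely continuous function with nonpositive derivative.
  let W : ℝ → ℝ := fun r => (u r * u r - 1 / 4) * Real.exp (Λ r)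
  have hW : AbsolutelyContinuousOnInterval W τ t := by
    refine AbsolutelyContinuousOnInterval.fun_mul ?_
      hEC.contDiffOn.absolutelyContinuousOnInterval
    exact (hu.fun_mul hu).fun_sub
      (contDiff_const.contDiffOn (𝕜 := ℝ) (n := 1)).absolutelyContinuousOnInterval
  have hW' : ∀ᵐ r, r ∈ Icc τ t → deriv W r ≤ 0 := by
    filter_upwards [hY', he', h1] with r hYr her h1r hr
    have hYr := hYr hr
    have her := her hr
    have h1r := h1r hr
    have hsd : HasDerivAt s (deriv s r) r := (hs.differentiable one_ne_zero r).hasDerivAt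
    have hi : HasDerivAt (fun r => (s r)⁻¹) (-deriv s r / s r ^ 2) r := hsd.inv (hs0 r)
    have hud := (her.mul (hi.pow 3)).sub (hYr.mul hi)
    have hud' : HasDerivAt u (-(a r / s r ^ 2) * ((1 + 3 * deriv s r * s r / a r) * u r +
        (ε r / s r ^ 3 + 2 * (deriv s r * Y r) / a r + s r * Y' r / a r))) r := by
      refine hud.congr_deriv ?_
      have ha0 : a r ≠ 0 := (hc.trans_le (hac r hr)).ne'
      have := hs0 r
      rw [show 3 - 1 = 2 from rfl]
      simp only [u, Pi.pow_apply]
      field_simp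
      push_cast
      ring
    have hWd := ((hud'.mul hud').sub_const (1 / 4)).mul (hE r)
    have hWd' : HasDerivAt W _ r := hWd
    rw [hWd'.deriv]
    have key := filter_energy_decay hc (u := u r) (spos r) (hs1 r hr) (hac r hr) (hε r hr) h1r
      (h2 r hr) (h3 r hr)
    rw [hAe r hr]
    simp only [Pi.mul_apply]
    have : 0 < Real.exp (Λ r) := Real.exp_pos _
    nlinarith
  have hWle : W t ≤ W τ := by
    have h := hW.integral_deriv_eq_sub
    have h' : ∫ x in τ..t, deriv W x ≤ 0 := by
      rw [intervalIntegral.integral_of_le hτt]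
      refine integral_nonpos_of_ae ?_
      rw [EventuallyLE, ae_restrict_iff' measurableSet_Ioc]
      filter_upwards [hW'] with r hr hr'
      exact hr (Ioc_subset_Icc_self hr')
    linarith
  have hΛt : c / 2 * (t - τ) ≤ Λ t := by
    have h := intervalIntegral.integral_mono_on (μ := volume) (a := τ) (b := t) (g := A)
      (f := fun _ => c / 2) hτt (by simp) (hAc.intervalIntegrable _ _) (fun r hr => by
        rw [hAe r hr]
        have : c ≤ a r / s r ^ 2 := by
          rw [le_div_iff₀ (by have := spos r; positivity)]
          have : s r ^ 2 ≤ 1 := pow_le_one₀ (spos r).le (hs1 r hr)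
          have := hac r hr
          nlinarith
        linarith)
    simp only [intervalIntegral.integral_const, smul_eq_mul] at h
    linarith
  have hut : u t * u t ≤ 1 := by
    have h0 : W τ ≤ K ^ 2 := by
      have : u τ * u τ ≤ K ^ 2 := by rw [← abs_mul_abs_self, sq]; exact mul_self_le_mul_self (abs_nonneg _) hK
      simp only [W, Λ, intervalIntegral.integral_same, Real.exp_zero]
      linarith
    have h5 : (u t * u t - 1 / 4) ≤ K ^ 2 * Real.exp (-Λ t) := by
      rw [Real.exp_neg, ← div_eq_mul_inv, le_div_iff₀ (Real.exp_pos _)]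
      exact hWle.trans h0
    have h6 : K ^ 2 * Real.exp (-Λ t) ≤ K ^ 2 * Real.exp (-(c / 2 * (t - τ))) := by gcongr
    linarith
  have hu1 : |u t| ≤ 1 := by
    rw [← abs_mul_abs_self] at hut
    nlinarith [abs_nonneg (u t)]
  have hst := spos t
  have heq : (s t)⁻¹ ^ 2 * (e t + ε t) - Y t = s t * u t + (s t)⁻¹ ^ 2 * ε t := by
    simp only [u]
    field_simp
    ring
  rw [heq]
  have h7 : |s t * u t| ≤ s t := by
    rw [abs_mul, abs_of_pos hst]; nlinarith
  have h8 : |(s t)⁻¹ ^ 2 * ε t| ≤ s t := by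
    rw [abs_mul, abs_of_pos (by positivity : 0 < (s t)⁻¹ ^ 2)]
    have := hε t ⟨hτt, le_rfl⟩
    calc (s t)⁻¹ ^ 2 * |ε t| ≤ (s t)⁻¹ ^ 2 * (s t ^ 3 / 8) := by gcongr
      _ = s t / 8 := by field_simp
      _ ≤ s t := by linarith
  linarith [abs_add_le (s t * u t) ((s t)⁻¹ ^ 2 * ε t)]

/-! ### Linear scalar equations and Grönwall's inequality -/

/-- Variation of constants for `ż = b - α z` on `[t₀, ∞)`. -/
theorem exists_linear_ode_solution {α b : ℝ → ℝ} {t₀ : ℝ} (z₀ : ℝ)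
    (hα : ContinuousOn α (Ici t₀)) (hb : ContinuousOn b (Ici t₀)) :
    ∃ z : ℝ → ℝ, ContinuousOn z (Ici t₀) ∧
      ∀ t, t₀ ≤ t → z t = z₀ + ∫ s in t₀..t, (b s - α s * z s) := by
  have hm : Continuous fun t => max t₀ t := by fun_prop
  have hm' : ∀ t, max t₀ t ∈ Ici t₀ := fun t => mem_Ici.2 (le_max_left _ _)
  have hαc : Continuous fun t => α (max t₀ t) := hα.comp_continuous hm hm'
  have hbc : Continuous fun t => b (max t₀ t) := hb.comp_continuous hm hm'
  set α' : ℝ → ℝ := fun t => α (max t₀ t)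
  set b' : ℝ → ℝ := fun t => b (max t₀ t)
  let A : ℝ → ℝ := fun t => ∫ s in t₀..t, α' s
  have hA : ∀ t, HasDerivAt A (α' t) t := fun t => (hαc.integral_hasStrictDerivAt t₀ t).hasDerivAt
  have hAc : Continuous A := continuous_iff_continuousAt.2 fun t => (hA t).continuousAt
  have hgc : Continuous fun s => Real.exp (A s) * b' s := by fun_prop
  let B : ℝ → ℝ := fun t => ∫ s in t₀..t, Real.exp (A s) * b' s
  have hB : ∀ t, HasDerivAt B (Real.exp (A t) * b' t) t :=
    fun t => (hgc.integral_hasStrictDerivAt t₀ t).hasDerivAt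
  let z : ℝ → ℝ := fun t => Real.exp (-A t) * (z₀ + B t)
  have hz : ∀ t, HasDerivAt z (b' t - α' t * z t) t := by
    intro t
    refine ((hA t).neg.exp.mul ((hB t).const_add z₀)).congr_deriv ?_
    have : Real.exp (-A t) * Real.exp (A t) = 1 := by rw [← Real.exp_add]; simp
    simp only [z, Pi.neg_apply]
    linear_combination b' t * this
  have hzc : Continuous z := continuous_iff_continuousAt.2 fun t => (hz t).continuousAt
  refine ⟨z, hzc.continuousOn, fun t ht => ?_⟩
  have h1 : ∫ s in t₀..t, (b s - α s * z s) = ∫ s in t₀..t, (b' s - α' s * z s) := by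
    refine intervalIntegral.integral_congr fun s hs => ?_
    rw [uIcc_of_le ht] at hs
    simp [α', b', max_eq_right hs.1]
  rw [h1, intervalIntegral.integral_eq_sub_of_hasDerivAt (fun s _ => hz s)
    (Continuous.intervalIntegrable (by fun_prop) _ _)]
  simp [z, A, B]

/-- Grönwall's inequality in integral form. -/
theorem le_gronwallBound_of_le_integral {v : ℝ → ℝ} {a b δ L ε : ℝ} (hL : 0 ≤ L)
    (hv : ContinuousOn v (Icc a b))
    (h : ∀ t ∈ Icc a b, v t ≤ δ + ∫ s in a..t, (L * v s + ε)) :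
    ∀ t ∈ Icc a b, v t ≤ gronwallBound δ L ε (t - a) := by
  intro t ht
  have hab : a ≤ b := ht.1.trans ht.2
  let v' : ℝ → ℝ := IccExtend hab ((Icc a b).domRestrict v)
  have hc : Continuous v' := Continuous.Icc_extend' (ContinuousOn.domRestrict hv)
  have hv' : ∀ s ∈ Icc a b, v' s = v s := fun s hs => IccExtend_of_mem _ _ hs
  let R : ℝ → ℝ := fun t => δ + ∫ s in a..t, (L * v' s + ε)
  have hgc : Continuous fun s => L * v' s + ε := by fun_prop
  have hR : ∀ t, HasDerivAt R (L * v' t + ε) t :=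
    fun t => (hgc.integral_hasStrictDerivAt a t).hasDerivAt.const_add δ
  have hvR : ∀ t ∈ Icc a b, v t ≤ R t := by
    intro t ht
    refine (h t ht).trans_eq ?_
    simp only [R]
    congr 1
    refine intervalIntegral.integral_congr fun s hs => ?_
    rw [uIcc_of_le ht.1] at hs
    simp only [hv' s ⟨hs.1, hs.2.trans ht.2⟩]
  refine (hvR t ht).trans ?_
  refine le_gronwallBound_of_liminf_deriv_right_le (f := R) (f' := fun t => L * v' t + ε) (b := b)
    (fun x _ => (hR x).continuousAt.continuousWithinAt)
    (fun x _ r hr => (hR x).hasDerivWithinAt.liminf_right_slope_le hr) (by simp [R])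
    (fun x hx => ?_) t ht
  have h1 := hvR x (Ico_subset_Icc_self hx)
  simp only [hv' x (Ico_subset_Icc_self hx)]
  gcongr

/-! ### Majorants of class `KL` -/

/-- The projection of the real line onto `[0, 1]`. -/
noncomputable def clamp (x : ℝ) : ℝ := max 0 (min 1 x)

theorem clamp_nonneg (x : ℝ) : 0 ≤ clamp x := le_max_left _ _

theorem clamp_le_one (x : ℝ) : clamp x ≤ 1 := by simp [clamp]

theorem clamp_of_one_le {x : ℝ} (h : 1 ≤ x) : clamp x = 1 := by simp [clamp, h]

theorem clamp_of_nonpos {x : ℝ} (h : x ≤ 0) : clamp x = 0 := by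
  simp [clamp, h]

theorem clamp_mono : Monotone clamp := fun _ _ h => max_le_max le_rfl (min_le_min le_rfl h)

theorem abs_clamp_sub_le (x y : ℝ) : |clamp x - clamp y| ≤ |x - y| := by
  unfold clamp
  grind

/-- Data `v j` at the points `(r j, t j)` lie below a function of class `KL` if they are bounded for
bounded `r j`, tend to zero as `t j → ∞` uniformly for bounded `r j`, and tend to zero as
`r j → 0`. The function is `ρ * exp (-s)`, for strict monotonicity, plus the supremum over `j` of
the products of `v j` with a piecewise linear cutoff, which is `1` at `(r j, t j)`, increasing in `ρ`
and zero for `ρ ≤ r j / 2`, decreasing in `s` and zero for `s ≥ t j + 1`. -/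
theorem exists_KL_majorant {J : Type*} (r t v : J → ℝ) (hr : ∀ j, 0 ≤ r j)
    (hbd : ∀ R, ∃ M, ∀ j, r j ≤ R → v j ≤ M)
    (hatt : ∀ R, ∀ ε > 0, ∃ τ, ∀ j, r j ≤ R → τ ≤ t j → v j ≤ ε)
    (hst : ∀ ε > 0, ∃ δ > 0, ∀ j, r j ≤ δ → v j ≤ ε) :
    ∃ σ, KL σ ∧ ∀ j, v j ≤ σ (r j) (t j) := by
  let V : J → ℝ := fun j => max (v j) 0
  -- For `r j = 0` the quotient is zero and so is the cutoff; this is harmless since then `V j = 0`.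
  let Φ : J → ℝ → ℝ → ℝ := fun j ρ s => V j * (clamp (2 * ρ / r j - 1) * clamp (t j - s + 1))
  have hV0 : ∀ j, 0 ≤ V j := fun j => le_max_right _ _
  have hVle : ∀ j {b : ℝ}, 0 ≤ b → v j ≤ b → V j ≤ b := fun j b hb h => max_le h hb
  have hΦ0 : ∀ j ρ s, 0 ≤ Φ j ρ s := fun j ρ s =>
    mul_nonneg (hV0 j) (mul_nonneg (clamp_nonneg _) (clamp_nonneg _))
  have hΦV : ∀ j ρ s, Φ j ρ s ≤ V j := fun j ρ s => mul_le_of_le_one_right (hV0 j)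
    (mul_le_one₀ (clamp_le_one _) (clamp_nonneg _) (clamp_le_one _))
  have hΦr : ∀ j {ρ s : ℝ}, 2 * ρ ≤ r j → Φ j ρ s = 0 := by
    intro j ρ s h
    have : 2 * ρ / r j - 1 ≤ 0 := by
      have := div_le_one_of_le₀ h (hr j)
      linarith
    simp only [Φ, clamp_of_nonpos this, zero_mul, mul_zero]
  have hΦt : ∀ j {ρ s : ℝ}, t j ≤ s - 1 → Φ j ρ s = 0 := by
    intro j ρ s h
    simp only [Φ, clamp_of_nonpos (show t j - s + 1 ≤ 0 by linarith), mul_zero]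
  have hΦle : ∀ ρ, ∃ M, 0 ≤ M ∧ ∀ j, r j ≤ 2 * ρ → V j ≤ M := by
    intro ρ
    obtain ⟨M, hM⟩ := hbd (2 * ρ)
    exact ⟨max M 0, le_max_right _ _, fun j hj => max_le_max (hM j hj) le_rfl⟩
  have hbdd : ∀ ρ s, BddAbove (range fun j => Φ j ρ s) := by
    intro ρ s
    obtain ⟨M, hM0, hM⟩ := hΦle ρ
    refine ⟨M, ?_⟩
    rintro _ ⟨j, rfl⟩
    rcases le_total (2 * ρ) (r j) with h | h
    · exact (hΦr j h).trans_le hM0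
    · exact (hΦV j ρ s).trans (hM j h)
  let G : ℝ → ℝ → ℝ := fun ρ s => ⨆ j, Φ j ρ s
  have hG0 : ∀ ρ s, 0 ≤ G ρ s := fun ρ s => Real.iSup_nonneg fun j => hΦ0 j ρ s
  have hΦG : ∀ j ρ s, Φ j ρ s ≤ G ρ s := fun j ρ s => le_ciSup (hbdd ρ s) j
  have hGle : ∀ {ρ s b : ℝ}, 0 ≤ b → (∀ j, Φ j ρ s ≤ b) → G ρ s ≤ b := fun hb h =>
    Real.iSup_le h hb
  have hGρ : ∀ s {ρ ρ' : ℝ}, ρ ≤ ρ' → G ρ s ≤ G ρ' s := by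
    intro s ρ ρ' h
    refine hGle (hG0 _ _) fun j => le_trans ?_ (hΦG j ρ' s)
    refine mul_le_mul_of_nonneg_left (mul_le_mul_of_nonneg_right (clamp_mono ?_)
      (clamp_nonneg _)) (hV0 j)
    have := hr j
    gcongr
  have hGs : ∀ ρ {s s' : ℝ}, s ≤ s' → G ρ s' ≤ G ρ s := by
    intro ρ s s' h
    refine hGle (hG0 _ _) fun j => le_trans ?_ (hΦG j ρ s)
    exact mul_le_mul_of_nonneg_left (mul_le_mul_of_nonneg_left (clamp_mono (by linarith))
      (clamp_nonneg _)) (hV0 j)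
  have hGlim : ∀ ρ, ∀ ε > 0, ∃ τ, ∀ s ≥ τ, G ρ s ≤ ε := by
    intro ρ ε hε
    obtain ⟨τ, hτ⟩ := hatt (2 * ρ) ε hε
    refine ⟨τ + 1, fun s hs => hGle hε.le fun j => ?_⟩
    rcases le_total (2 * ρ) (r j) with h | h
    · exact (hΦr j h).trans_le hε.le
    · rcases le_total (t j) (s - 1) with h' | h'
      · exact (hΦt j h').trans_le hε.le
      · exact (hΦV j ρ s).trans (hVle j hε.le (hτ j h (by linarith)))
  have hGz : ∀ ε > 0, ∃ δ > 0, ∀ ρ s, ρ ≤ δ → G ρ s ≤ ε := by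
    intro ε hε
    obtain ⟨δ, hδ, h⟩ := hst ε hε
    refine ⟨δ / 2, by positivity, fun ρ s hρ => hGle hε.le fun j => ?_⟩
    rcases le_total (2 * ρ) (r j) with h' | h'
    · exact (hΦr j h').trans_le hε.le
    · exact (hΦV j ρ s).trans (hVle j hε.le (h j (by linarith)))
  have hGzero : ∀ s, G 0 s = 0 := fun s =>
    le_antisymm (hGle le_rfl fun j => (hΦr j (by simpa using hr j)).le) (hG0 _ _)
  -- Away from `ρ = 0` the functions `Φ j` are equi-Lipschitz, hence so is their supremum.
  have hGlip : ∀ ρ₁ ρ₂ : ℝ, 0 < ρ₁ → ∃ M, ∀ ρ ∈ Icc ρ₁ ρ₂, ∀ ρ' ∈ Icc ρ₁ ρ₂, ∀ s s',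
      G ρ s ≤ G ρ' s' + M * (2 / ρ₁ * |ρ - ρ'| + |s - s'|) := by
    intro ρ₁ ρ₂ hρ₁
    obtain ⟨M, hM0, hM⟩ := hΦle ρ₂
    refine ⟨M, fun ρ hρ ρ' hρ' s s' => ?_⟩
    have hnn : 0 ≤ M * (2 / ρ₁ * |ρ - ρ'| + |s - s'|) := by positivity
    refine hGle (add_nonneg (hG0 _ _) hnn) fun j => ?_
    rcases le_total (2 * ρ₂) (r j) with h | h
    · rw [hΦr j (by linarith [hρ.2])]
      exact add_nonneg (hG0 _ _) hnn
    refine le_trans ?_ (add_le_add_left (hΦG j ρ' s') _)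
    have hK : |clamp (2 * ρ / r j - 1) - clamp (2 * ρ' / r j - 1)| ≤ 2 / ρ₁ * |ρ - ρ'| := by
      rcases (hr j).eq_or_lt with h0 | h0
      · simp only [← h0, div_zero, sub_self, abs_zero]
        positivity
      rcases le_total (r j) ρ₁ with h1 | h1
      · have : ∀ x ∈ Icc ρ₁ ρ₂, clamp (2 * x / r j - 1) = 1 := by
          intro x hx
          refine clamp_of_one_le ?_
          have : 2 ≤ 2 * x / r j := by
            rw [le_div_iff₀ h0]
            linarith [hx.1]
          linarith
        rw [this ρ hρ, this ρ' hρ', sub_self, abs_zero]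
        positivity
      · refine (abs_clamp_sub_le _ _).trans ?_
        rw [show 2 * ρ / r j - 1 - (2 * ρ' / r j - 1) = 2 / r j * (ρ - ρ') by ring, abs_mul,
          abs_of_pos (by positivity)]
        gcongr
    have hH : |clamp (t j - s + 1) - clamp (t j - s' + 1)| ≤ |s - s'| := by
      refine (abs_clamp_sub_le _ _).trans_eq ?_
      rw [← abs_neg]
      congr 1
      ring
    have h1 := clamp_nonneg (2 * ρ / r j - 1)
    have h2 := clamp_le_one (2 * ρ / r j - 1)
    have h3 := clamp_nonneg (t j - s' + 1)
    have h4 := clamp_le_one (t j - s' + 1)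
    have hMj := hM j h
    have hVj := hV0 j
    simp only [Φ]
    generalize clamp (2 * ρ / r j - 1) = k at *
    generalize clamp (2 * ρ' / r j - 1) = k' at *
    generalize clamp (t j - s + 1) = l at *
    generalize clamp (t j - s' + 1) = l' at *
    have h5 : k * l - k' * l' ≤ 2 / ρ₁ * |ρ - ρ'| + |s - s'| := by
      have e : k * l - k' * l' = k * (l - l') + (k - k') * l' := by ring
      have e1 : k * (l - l') ≤ |l - l'| := by
        have := le_abs_self (l - l')
        have := abs_nonneg (l - l')
        nlinarith
      have e2 : (k - k') * l' ≤ |k - k'| := by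
        have := le_abs_self (k - k')
        have := abs_nonneg (k - k')
        nlinarith
      linarith
    have h6 : V j * (k * l - k' * l') ≤ M * (2 / ρ₁ * |ρ - ρ'| + |s - s'|) :=
      (mul_le_mul_of_nonneg_left h5 hVj).trans
        (mul_le_mul_of_nonneg_right hMj (by positivity))
    linarith
  -- At `ρ = 0` continuity comes from the smallness for small `ρ`.
  have hGcont : ContinuousOn (fun p : ℝ × ℝ => G p.1 p.2) (Ici 0 ×ˢ Ici 0) := by
    rintro ⟨ρ₀, s₀⟩ ⟨hρ₀, hs₀⟩
    rcases (show 0 ≤ ρ₀ from hρ₀).eq_or_lt with h0 | h0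
    · subst h0
      rw [Metric.continuousWithinAt_iff]
      intro ε hε
      obtain ⟨δ, hδ, h⟩ := hGz (ε / 2) (by positivity)
      refine ⟨δ, hδ, ?_⟩
      rintro ⟨ρ, s⟩ ⟨hρ, hs⟩ hd
      have hd1 : |ρ| < δ := by
        have := (le_max_left _ _).trans_lt hd
        simpa [Real.dist_eq] using this
      simp only [hGzero, Real.dist_eq, sub_zero, abs_of_nonneg (hG0 _ _)]
      linarith [h ρ s ((le_abs_self ρ).trans hd1.le)]
    · refine ContinuousAt.continuousWithinAt ?_
      obtain ⟨M, hM⟩ := hGlip (ρ₀ / 2) (2 * ρ₀) (half_pos h0)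
      have hlim : Tendsto (fun p : ℝ × ℝ => M * (2 / (ρ₀ / 2) * |p.1 - ρ₀| + |p.2 - s₀|))
          (𝓝 (ρ₀, s₀)) (𝓝 0) := by
        have : Continuous fun p : ℝ × ℝ => M * (2 / (ρ₀ / 2) * |p.1 - ρ₀| + |p.2 - s₀|) := by
          fun_prop
        simpa using this.tendsto (ρ₀, s₀)
      refine tendsto_iff_dist_tendsto_zero.2 (squeeze_zero' (Eventually.of_forall fun _ =>
        dist_nonneg) ?_ hlim)
      have hn : ∀ᶠ p : ℝ × ℝ in 𝓝 (ρ₀, s₀), p.1 ∈ Icc (ρ₀ / 2) (2 * ρ₀) :=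
        continuous_fst.continuousAt.eventually
          (Icc_mem_nhds (by dsimp only; linarith) (by dsimp only; linarith))
      filter_upwards [hn] with p hp
      have hm : ρ₀ ∈ Icc (ρ₀ / 2) (2 * ρ₀) := ⟨by linarith, by linarith⟩
      have h1 := hM p.1 hp ρ₀ hm p.2 s₀
      have h2 := hM ρ₀ hm p.1 hp s₀ p.2
      rw [abs_sub_comm ρ₀, abs_sub_comm s₀] at h2
      rw [Real.dist_eq, abs_le]
      constructor <;> linarith
  refine ⟨fun ρ s => ρ * Real.exp (-s) + G ρ s, ⟨?_, ?_, ?_, ?_, ?_⟩, ?_⟩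
  · exact ContinuousOn.add (by fun_prop) hGcont
  · intro s _ ρ _ ρ' _ h
    exact add_lt_add_of_lt_of_le (mul_lt_mul_of_pos_right h (Real.exp_pos _)) (hGρ s h.le)
  · intro s _
    simp [hGzero]
  · intro ρ hρ s _ s' _ h
    exact add_le_add (mul_le_mul_of_nonneg_left (Real.exp_le_exp.2 (by linarith)) hρ) (hGs ρ h)
  · intro ρ _
    have h1 : Tendsto (fun s : ℝ => ρ * Real.exp (-s)) atTop (𝓝 0) := by
      simpa using (Real.tendsto_exp_neg_atTop_nhds_zero).const_mul ρ
    have h2 : Tendsto (G ρ) atTop (𝓝 0) := by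
      rw [Metric.tendsto_atTop]
      intro ε hε
      obtain ⟨τ, hτ⟩ := hGlim ρ (ε / 2) (by positivity)
      refine ⟨τ, fun s hs => ?_⟩
      rw [Real.dist_eq, sub_zero, abs_of_nonneg (hG0 _ _)]
      linarith [hτ s hs]
    simpa using h1.add h2
  · intro j
    have h1 : V j ≤ Φ j (r j) (t j) := by
      rcases (hr j).eq_or_lt with h0 | h0
      · have : V j ≤ 0 := by
          refine le_of_forall_pos_le_add fun ε hε => ?_
          obtain ⟨δ, hδ, h⟩ := hst ε hε
          rw [zero_add]
          exact hVle j hε.le (h j (by rw [← h0]; exact hδ.le))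
        exact this.trans (hΦ0 _ _ _)
      · simp only [Φ]
        rw [clamp_of_one_le (show 1 ≤ 2 * r j / r j - 1 by
          rw [mul_div_assoc, div_self h0.ne']; norm_num), clamp_of_one_le (by simp)]
        simp
    calc v j ≤ V j := le_max_left _ _
      _ ≤ G (r j) (t j) := h1.trans (hΦG _ _ _)
      _ ≤ _ := le_add_of_nonneg_left (mul_nonneg (hr j) (Real.exp_pos _).le)

/-- The version of `exists_KL_majorant` for data that satisfy its hypotheses only uniformly over
initial times `t₀ i ≤ T`. The weight `β` grows so fast that `β (t₀ i) * r i ≤ N` and `N ≤ t₀ i`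
force `v i` to be at most `1 / (N + 1)`, so that late initial times do no harm. -/
theorem exists_KL_KPlus_majorant {ι : Type*} (t₀ r : ι → ℝ) (v : ι → ℝ → ℝ)
    (hr : ∀ i, 0 ≤ r i)
    (hbd : ∀ T R, ∃ M, ∀ i, t₀ i ≤ T → r i ≤ R → ∀ s, 0 ≤ s → v i s ≤ M)
    (hatt : ∀ T R, ∀ ε > 0, ∃ τ, ∀ i, t₀ i ≤ T → r i ≤ R → ∀ s, 0 ≤ s → τ ≤ s → v i s ≤ ε)
    (hst : ∀ T, ∀ ε > 0, ∃ δ > 0, ∀ i, t₀ i ≤ T → r i ≤ δ → ∀ s, 0 ≤ s → v i s ≤ ε) :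
    ∃ σ β, KL σ ∧ KPlus β ∧ ∀ i s, 0 ≤ s → v i s ≤ σ (β (t₀ i) * r i) s := by
  have hpos : ∀ N : ℕ, (0 : ℝ) < 1 / (N + 1) := fun N => Nat.one_div_pos_of_nat
  choose δ hδ hδv using fun N : ℕ => hst N (1 / (N + 1)) (hpos N)
  obtain ⟨μ, hμa, hμp, hμ⟩ := exists_antitone_le_seq (fun N : ℕ => min 1 (δ N / (N + 1)))
    (fun N => lt_min one_pos (by have := hδ N; positivity))
  obtain ⟨s, hsC, -, hsp, hsμ, -⟩ := exists_contDiff_antitone_le μ hμa hμp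
  have hs1 : ∀ t, s t ≤ 1 := fun t => (hsμ t).trans ((hμ t).trans (min_le_left _ _))
  have hβ : ∀ t, 0 < (s t)⁻¹ := fun t => inv_pos.2 (hsp t)
  have hrle : ∀ i {ρ : ℝ}, (s (t₀ i))⁻¹ * r i ≤ ρ → r i ≤ s (t₀ i) * ρ := by
    intro i ρ h
    rwa [inv_mul_le_iff₀ (hsp _)] at h
  have hrle1 : ∀ i {ρ : ℝ}, (s (t₀ i))⁻¹ * r i ≤ ρ → r i ≤ ρ := by
    intro i ρ h
    have h0 : 0 ≤ ρ := le_trans (mul_nonneg (hβ _).le (hr i)) h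
    exact (hrle i h).trans (mul_le_of_le_one_left h0 (hs1 _))
  -- Initial times that are late compared with `ρ` contribute little, by the choice of the weight.
  have hlate : ∀ i {ρ : ℝ}, (s (t₀ i))⁻¹ * r i ≤ ρ → ∀ N : ℕ, ρ ≤ N + 1 → N ≤ t₀ i →
      ∀ t, 0 ≤ t → v i t ≤ 1 / (N + 1) := by
    intro i ρ h N hN hNt t ht
    have h0 : 0 ≤ ρ := le_trans (mul_nonneg (hβ _).le (hr i)) h
    have hN' : (N : ℝ) ≤ (⌈t₀ i⌉₊ : ℝ) := hNt.trans (Nat.le_ceil _)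
    have h1 : r i ≤ δ ⌈t₀ i⌉₊ := by
      refine (hrle i h).trans ?_
      have h2 : s (t₀ i) ≤ δ ⌈t₀ i⌉₊ / (⌈t₀ i⌉₊ + 1) :=
        (hsμ _).trans ((hμ _).trans (min_le_right _ _))
      calc s (t₀ i) * ρ ≤ δ ⌈t₀ i⌉₊ / (⌈t₀ i⌉₊ + 1) * (⌈t₀ i⌉₊ + 1) := by
            have := hδ ⌈t₀ i⌉₊
            gcongr
            linarith
        _ = δ ⌈t₀ i⌉₊ := div_mul_cancel₀ _ (by positivity)
    refine (hδv _ i (Nat.le_ceil _) h1 t ht).trans ?_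
    gcongr
  obtain ⟨σ, hσ, hσv⟩ := exists_KL_majorant (J := ι × {t : ℝ // 0 ≤ t})
    (fun j => (s (t₀ j.1))⁻¹ * r j.1) (fun j => j.2) (fun j => v j.1 j.2)
    (fun j => mul_nonneg (hβ _).le (hr _))
    (fun R => by
      obtain ⟨N, hN⟩ := exists_nat_ge R
      obtain ⟨M, hM⟩ := hbd N R
      refine ⟨max M 1, fun j hj => ?_⟩
      rcases le_total (t₀ j.1) N with h | h
      · exact (hM j.1 h (hrle1 _ hj) _ j.2.2).trans (le_max_left _ _)
      · refine (hlate j.1 hj N (by linarith) h _ j.2.2).trans (le_trans ?_ (le_max_right _ _))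
        rw [div_le_one (by positivity)]
        linarith [(Nat.cast_nonneg N : (0 : ℝ) ≤ N)])
    (fun R ε hε => by
      obtain ⟨N₁, hN₁⟩ := exists_nat_ge R
      obtain ⟨N₂, hN₂⟩ := exists_nat_one_div_lt hε
      obtain ⟨τ, hτ⟩ := hatt (max N₁ N₂ : ℕ) R ε hε
      refine ⟨τ, fun j hj hjt => ?_⟩
      rcases le_total (t₀ j.1) (max N₁ N₂ : ℕ) with h | h
      · exact hτ j.1 h (hrle1 _ hj) _ j.2.2 hjt
      · have h1 : (N₁ : ℝ) ≤ (max N₁ N₂ : ℕ) := by exact_mod_cast le_max_left _ _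
        have h2 : (N₂ : ℝ) ≤ (max N₁ N₂ : ℕ) := by exact_mod_cast le_max_right _ _
        refine (hlate j.1 hj _ (by linarith) h _ j.2.2).trans (le_trans ?_ hN₂.le)
        gcongr)
    (fun ε hε => by
      obtain ⟨N, hN⟩ := exists_nat_one_div_lt hε
      obtain ⟨d, hd, hdv⟩ := hst N ε hε
      refine ⟨min d 1, lt_min hd one_pos, fun j hj => ?_⟩
      rcases le_total (t₀ j.1) N with h | h
      · exact hdv j.1 h ((hrle1 _ hj).trans (min_le_left _ _)) _ j.2.2
      · refine (hlate j.1 (hj.trans (min_le_right _ _)) N ?_ h _ j.2.2).trans hN.le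
        linarith [(Nat.cast_nonneg N : (0 : ℝ) ≤ N)])
  refine ⟨σ, fun t => (s t)⁻¹, hσ, ⟨?_, fun t _ => hβ t⟩, fun i t ht => hσv (i, ⟨t, ht⟩)⟩
  exact (hsC.continuous.inv₀ fun t => (hsp t).ne').continuousOn

/-! ### Robust forward completeness and `KL` estimates -/

section Solutions

variable {X U : Type*} [NormedAddCommGroup X]

/-- A family vanishing at zero is uniformly small near zero on bounded time intervals. -/
theorem ContState.exists_le_near_zero [ProperSpace X] {G : ℝ → X → ℝ} (hG : ContState G)
    (hG0 : ∀ t, 0 ≤ t → G t 0 = 0) (T : ℝ) {ε : ℝ} (hε : 0 < ε) :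
    ∃ δ > 0, ∀ t ∈ Icc 0 T, ∀ w, ‖w‖ < δ → G t w ≤ ε := by
  have hK : IsCompact (Icc 0 T ×ˢ Metric.closedBall (0 : X) 1) :=
    isCompact_Icc.prod (isCompact_closedBall _ _)
  have hc : ContinuousOn (fun p : ℝ × X => G p.1 p.2) (Icc 0 T ×ˢ Metric.closedBall (0 : X) 1) :=
    hG.mono (prod_mono Icc_subset_Ici_self (subset_univ _))
  have hu := Metric.uniformContinuousOn_iff.1 (hK.uniformContinuousOn_of_continuous hc)
  obtain ⟨δ, hδ, h⟩ := hu ε hε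
  refine ⟨min δ 1, lt_min hδ one_pos, fun t ht w hw => ?_⟩
  have h1 := h (t, w) ⟨ht, by simpa using (hw.trans_le (min_le_right _ _)).le⟩ (t, 0)
    ⟨ht, by simp⟩ (by simpa [Prod.dist_eq, hδ] using hw.trans_le (min_le_left _ _))
  simp only [hG0 t ht.1, Real.dist_eq, sub_zero] at h1
  exact (le_abs_self _).trans h1.le

theorem ContState.exists_bound [ProperSpace X] {Y : Type*} [NormedAddCommGroup Y] {G : ℝ → X → Y}
    (hG : ContState G) (T C : ℝ) :
    ∃ M, 0 ≤ M ∧ ∀ t ∈ Icc 0 T, ∀ w, ‖w‖ ≤ C → ‖G t w‖ ≤ M := by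
  have hK : IsCompact (Icc 0 T ×ˢ Metric.closedBall (0 : X) C) :=
    isCompact_Icc.prod (isCompact_closedBall _ _)
  obtain ⟨M, hM⟩ := hK.exists_bound_of_continuousOn
    (hG.mono (prod_mono Icc_subset_Ici_self (subset_univ _)))
  exact ⟨max M 0, le_max_right _ _, fun t ht w hw =>
    (hM (t, w) ⟨ht, by simpa using hw⟩).trans (le_max_left _ _)⟩

variable [NormedSpace ℝ X]

theorem IsSolution.norm_le_gronwallBound {f : ℝ → X → U → X} {d : ℝ → U} {t₀ : ℝ} {x₀ : X}
    {x : ℝ → X} (hx : IsSolution f d t₀ x₀ x) {L ε T : ℝ} (hL : 0 ≤ L)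
    (h : ∀ s ∈ Icc t₀ T, ‖f s (x s) (d s)‖ ≤ L * ‖x s‖ + ε) {t : ℝ} (ht : t ∈ Icc t₀ T) :
    ‖x t‖ ≤ gronwallBound ‖x₀‖ L ε (t - t₀) := by
  have hc : ContinuousOn (fun s => ‖x s‖) (Icc t₀ T) := (hx.cont.mono Icc_subset_Ici_self).norm
  refine le_gronwallBound_of_le_integral (v := fun s => ‖x s‖) hL hc (fun r hr => ?_) t ht
  rw [hx.eq r hr.1]
  refine (norm_add_le _ _).trans (add_le_add_right ?_ _)
  refine intervalIntegral.norm_integral_le_of_norm_le hr.1 ?_ ?_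
  · filter_upwards with s hs
    exact h s ⟨hs.1.le, hs.2.trans hr.2⟩
  · refine ContinuousOn.intervalIntegrable ?_
    rw [uIcc_of_le hr.1]
    have := hc.mono (Icc_subset_Icc_right hr.2)
    fun_prop

variable [MeasurableSpace U]

/-- `Q t (w t)` holds along all solutions `w` from some time on, which is uniform over bounded
initial times, bounded initial states and all disturbances. -/
def UniformlyEventually (D : Set U) (f : ℝ → X → U → X) (Q : ℝ → X → Prop) : Prop :=
  ∀ T R : ℝ, ∃ τ : ℝ, ∀ t₀ ∈ Icc 0 T, ∀ w₀ : X, ‖w₀‖ ≤ R → ∀ d ∈ Disturbances D, ∀ w,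
    IsSolution f d t₀ w₀ w → ∀ t, t₀ ≤ t → τ ≤ t → Q t (w t)

/-- For a robustly forward complete system whose right-hand side is bounded by a multiple of `‖w‖`
on bounded sets, a continuous function `G` of time and state that vanishes at the zero state and
becomes small along all solutions, uniformly over bounded initial data, satisfies a `KL` estimate.
Smallness for small initial data on the initial time interval comes from Grönwall's inequality. -/
theorem RFC.exists_KL_estimate [ProperSpace X] {D : Set U} {f : ℝ → X → U → X} (hf : RFC D f)
    (hlin : ∀ T C : ℝ, ∃ L : ℝ, 0 ≤ L ∧ ∀ t ∈ Icc 0 T, ∀ w, ‖w‖ ≤ C → ∀ d ∈ D,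
      ‖f t w d‖ ≤ L * ‖w‖)
    {G : ℝ → X → ℝ} (hG : ContState G) (hG0 : ∀ t, 0 ≤ t → G t 0 = 0)
    (hatt : ∀ ε > 0, UniformlyEventually D f fun t w => G t w ≤ ε)
    {N : X → ℝ} (hN : ∀ w, ‖w‖ ≤ N w) :
    ∃ σ β, KL σ ∧ KPlus β ∧ ∀ t₀, 0 ≤ t₀ → ∀ w₀ : X, ∀ d ∈ Disturbances D, ∀ w,
      IsSolution f d t₀ w₀ w → ∀ t, t₀ ≤ t → G t (w t) ≤ σ (β t₀ * N w₀) (t - t₀) := by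
  let ι := {q : ℝ × X × (ℝ → U) × (ℝ → X) // 0 ≤ q.1 ∧ q.2.2.1 ∈ Disturbances D ∧
    IsSolution f q.2.2.1 q.1 q.2.1 q.2.2.2}
  suffices H : ∃ σ β, KL σ ∧ KPlus β ∧ ∀ (i : ι) s, 0 ≤ s →
      G (i.1.1 + s) (i.1.2.2.2 (i.1.1 + s)) ≤ σ (β i.1.1 * N i.1.2.1) s by
    obtain ⟨σ, β, hσ, hβ, h⟩ := H
    refine ⟨σ, β, hσ, hβ, fun t₀ ht₀ w₀ d hd w hw t ht => ?_⟩
    have := h ⟨(t₀, w₀, d, w), ht₀, hd, hw⟩ (t - t₀) (by linarith)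
    simpa using this
  refine exists_KL_KPlus_majorant (ι := ι) (fun i => i.1.1)
    (fun i => N i.1.2.1) (fun i s => G (i.1.1 + s) (i.1.2.2.2 (i.1.1 + s)))
    (fun i => (norm_nonneg _).trans (hN _)) ?_ ?_ ?_
  · intro T R
    obtain ⟨τ, hτ⟩ := hatt 1 one_pos T R
    obtain ⟨C, hC⟩ := hf.bounded (max 0 (max T τ)) (le_max_left _ _) (max R 0) (le_max_right _ _)
    obtain ⟨M, -, hM⟩ := hG.exists_bound τ C
    refine ⟨max M 1, ?_⟩
    rintro ⟨⟨t₀, w₀, d, w⟩, ht₀, hd, hw⟩ hT hR s hs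
    dsimp only at *
    rcases le_total τ (t₀ + s) with h | h
    · exact (hτ t₀ ⟨ht₀, hT⟩ w₀ ((hN _).trans hR) d hd w hw _ (by linarith) h).trans
        (le_max_right _ _)
    · have h1 := hC t₀ ⟨ht₀, by simp [hT]⟩ w₀ ((hN _).trans (hR.trans (le_max_left _ _))) d hd w hw
        s ⟨hs, by simp only [le_max_iff]; right; right; linarith⟩
      exact (le_abs_self _).trans ((hM _ ⟨by linarith, h⟩ _ h1).trans (le_max_left _ _))
  · intro T R ε hε
    obtain ⟨τ, hτ⟩ := hatt ε hε T R
    refine ⟨τ, ?_⟩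
    rintro ⟨⟨t₀, w₀, d, w⟩, ht₀, hd, hw⟩ hT hR s hs hs'
    dsimp only at *
    exact hτ t₀ ⟨ht₀, hT⟩ w₀ ((hN _).trans hR) d hd w hw _ (by linarith) (by linarith)
  · intro T ε hε
    obtain ⟨τ, hτ⟩ := hatt ε hε T 1
    set T' := max 0 (max T τ) with hT'
    have hT0 : 0 ≤ T' := le_max_left _ _
    obtain ⟨C, hC⟩ := hf.bounded T' hT0 1 zero_le_one
    obtain ⟨L, hL, hLf⟩ := hlin (T' + T') C
    obtain ⟨δ, hδ, hδG⟩ := hG.exists_le_near_zero hG0 τ hε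
    have hE : 0 < Real.exp (L * T') := Real.exp_pos _
    refine ⟨min 1 (δ / Real.exp (L * T') / 2), lt_min one_pos (by positivity), ?_⟩
    rintro ⟨⟨t₀, w₀, d, w⟩, ht₀, hd, hw⟩ hT hR s hs
    dsimp only at *
    have hw1 : ‖w₀‖ ≤ 1 := (hN _).trans (hR.trans (min_le_left _ _))
    have htT : t₀ ≤ T' := by simp [hT', hT]
    rcases le_total τ (t₀ + s) with h | h
    · exact hτ t₀ ⟨ht₀, hT⟩ w₀ hw1 d hd w hw _ (by linarith) h
    have hsT : s ≤ T' := by simp only [hT', le_max_iff]; right; right; linarith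
    refine hδG _ ⟨by linarith, h⟩ _ ?_
    have h1 := hw.norm_le_gronwallBound (ε := 0) (T := t₀ + s) hL (fun r hr => by
      have := hC t₀ ⟨ht₀, htT⟩ w₀ hw1 d hd w hw (r - t₀) ⟨by linarith [hr.1], by linarith [hr.2]⟩
      rw [add_sub_cancel] at this
      rw [add_zero]
      exact hLf r ⟨by linarith [hr.1], by linarith [hr.2]⟩ _ this _ (hd.2 r (by linarith [hr.1])))
      (t := t₀ + s) ⟨by linarith, le_rfl⟩
    rw [gronwallBound_ε0, add_sub_cancel_left] at h1
    have h2 : ‖w₀‖ ≤ δ / Real.exp (L * T') / 2 := (hN _).trans (hR.trans (min_le_right _ _))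
    calc ‖w (t₀ + s)‖ ≤ ‖w₀‖ * Real.exp (L * s) := h1
      _ ≤ δ / Real.exp (L * T') / 2 * Real.exp (L * T') := by gcongr
      _ = δ / 2 := by field_simp
      _ < δ := half_lt_self hδ

end Solutions

/-! ### The chain rule along solutions -/

section Trajectories

variable {n k q : ℕ} {D : Set (E q)} {f : ℝ → E n → E q → E n} {h : ℝ → E n → E k}

theorem IsSystem.exists_bound (hsys : IsSystem D f h) (T C : ℝ) :
    ∃ M, 0 ≤ M ∧ ∀ t ∈ Icc 0 T, ∀ x, ‖x‖ ≤ C → ∀ d ∈ D, ‖f t x d‖ ≤ M := by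
  have hK : IsCompact (Icc 0 T ×ˢ Metric.closedBall (0 : E n) C ×ˢ D) :=
    isCompact_Icc.prod ((isCompact_closedBall _ _).prod hsys.compact)
  obtain ⟨M, hM⟩ := hK.exists_bound_of_continuousOn
    (hsys.f_cont.mono (prod_mono Icc_subset_Ici_self (prod_mono (subset_univ _) le_rfl)))
  exact ⟨max M 0, le_max_right _ _, fun t ht w hw d hd =>
    (hM (t, w, d) ⟨ht, by simpa using hw, hd⟩).trans (le_max_left _ _)⟩

theorem exists_norm_le_of_continuousOn_Ici {x : ℝ → E n} {t₀ : ℝ} (hx : ContinuousOn x (Ici t₀))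
    (T : ℝ) : ∃ C, 0 ≤ C ∧ ∀ t ∈ Icc t₀ T, ‖x t‖ ≤ C := by
  obtain ⟨C, hC⟩ := isCompact_Icc.exists_bound_of_continuousOn (hx.mono Icc_subset_Ici_self)
  exact ⟨max C 0, le_max_right _ _, fun t ht => (hC t ht).trans (le_max_left _ _)⟩

theorem IsSolution.lipschitzOnWith {X U : Type*} [NormedAddCommGroup X] [NormedSpace ℝ X]
    {f : ℝ → X → U → X} {d : ℝ → U} {t₀ : ℝ} {x₀ : X} {x : ℝ → X}
    (hx : IsSolution f d t₀ x₀ x) {T : ℝ} {M : ℝ≥0}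
    (hM : ∀ s ∈ Icc t₀ T, ‖f s (x s) (d s)‖ ≤ M) : LipschitzOnWith M x (Icc t₀ T) := by
  refine LipschitzOnWith.of_dist_le_mul fun s hs t ht => ?_
  rw [dist_eq_norm, hx.eq s hs.1, hx.eq t ht.1, add_sub_add_left_eq_sub,
    intervalIntegral.integral_interval_sub_left (hx.integrable s hs.1) (hx.integrable t ht.1),
    Real.dist_eq]
  exact intervalIntegral.norm_integral_le_of_norm_le_const fun r hr =>
    hM r (uIcc_subset_Icc ht hs (uIoc_subset_uIcc hr))

theorem IsSolution.exists_lipschitzOnWith (hsys : IsSystem D f h) {d : ℝ → E q}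
    (hd : d ∈ Disturbances D) {t₀ : ℝ} (ht₀ : 0 ≤ t₀) {x₀ : E n} {x : ℝ → E n}
    (hx : IsSolution f d t₀ x₀ x) (T : ℝ) : ∃ L : ℝ≥0, LipschitzOnWith L x (Icc t₀ T) := by
  obtain ⟨C, -, hC⟩ := exists_norm_le_of_continuousOn_Ici hx.cont T
  obtain ⟨M, hM0, hM⟩ := hsys.exists_bound T C
  exact ⟨⟨M, hM0⟩, hx.lipschitzOnWith fun r hr =>
    hM r ⟨ht₀.trans hr.1, hr.2⟩ _ (hC r hr) _ (hd.2 r (ht₀.trans hr.1))⟩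

theorem IsSolution.ae_hasDerivAt {X U : Type*} [NormedAddCommGroup X] [NormedSpace ℝ X]
    [CompleteSpace X] {f : ℝ → X → U → X} {d : ℝ → U} {t₀ : ℝ} {x₀ : X} {x : ℝ → X}
    (hx : IsSolution f d t₀ x₀ x) (T : ℝ) :
    ∀ᵐ t, t ∈ Icc t₀ T → t₀ < t ∧ HasDerivAt x (f t (x t) (d t)) t := by
  rcases lt_or_ge T t₀ with hT | hT
  · simp [Icc_eq_empty_of_lt hT]
  have h₁ : ∀ᵐ t : ℝ, t ≠ t₀ := by simp [ae_iff, measure_singleton]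
  filter_upwards [(hx.integrable T hT).ae_hasDerivAt_integral, h₁] with t ht hne hm
  have hlt : t₀ < t := lt_of_le_of_ne hm.1 hne.symm
  refine ⟨hlt, ?_⟩
  rw [uIcc_of_le hT] at ht
  refine ((ht hm t₀ ⟨le_rfl, hT⟩).const_add x₀).congr_of_eventuallyEq ?_
  filter_upwards [Ioi_mem_nhds hlt] with s hs
  exact hx.eq s (le_of_lt hs)

/-- Almost everywhere along a solution a `C¹` function of `(t, x)` has the expected derivative. -/
theorem IsSolution.ae_hasDerivAt_comp {d : ℝ → E q} {t₀ : ℝ} (ht₀ : 0 ≤ t₀) {x₀ : E n}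
    {x : ℝ → E n} (hx : IsSolution f d t₀ x₀ x) {u : ℝ × E n → ℝ}
    (hu : ContDiffOn ℝ 1 u (Ici 0 ×ˢ univ)) (T : ℝ) :
    ∀ᵐ t, t ∈ Icc t₀ T → HasDerivAt (fun t => u (t, x t))
      (fderivWithin ℝ u (Ici 0 ×ˢ univ) (t, x t) (1, f t (x t) (d t))) t := by
  filter_upwards [hx.ae_hasDerivAt T] with t ht hm
  obtain ⟨hlt, hd⟩ := ht hm
  have hn : Ici (0 : ℝ) ×ˢ (univ : Set (E n)) ∈ 𝓝 (t, x t) :=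
    prod_mem_nhds (Ici_mem_nhds (ht₀.trans_lt hlt)) univ_mem
  have hf : HasFDerivAt u (fderivWithin ℝ u (Ici 0 ×ˢ univ) (t, x t)) (t, x t) :=
    ((hu.differentiableOn one_ne_zero) (t, x t)
      ⟨(ht₀.trans_lt hlt).le, mem_univ _⟩).hasFDerivWithinAt.hasFDerivAt hn
  exact hf.comp_hasDerivAt t ((hasDerivAt_id t).prodMk hd)

theorem IsSolution.absolutelyContinuous_comp (hsys : IsSystem D f h) {d : ℝ → E q}
    (hd : d ∈ Disturbances D) {t₀ : ℝ} (ht₀ : 0 ≤ t₀) {x₀ : E n} {x : ℝ → E n}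
    (hx : IsSolution f d t₀ x₀ x) {u : ℝ × E n → ℝ}
    (hu : ContDiffOn ℝ 1 u (Ici 0 ×ˢ univ)) {τ t : ℝ} (hτ : t₀ ≤ τ) (ht : τ ≤ t) :
    AbsolutelyContinuousOnInterval (fun t => u (t, x t)) τ t := by
  obtain ⟨C, -, hC⟩ := exists_norm_le_of_continuousOn_Ici hx.cont t
  obtain ⟨L, hL⟩ := hx.exists_lipschitzOnWith hsys hd ht₀ t
  have hsub : Icc 0 t ×ˢ Metric.closedBall (0 : E n) C ⊆ Ici 0 ×ˢ univ :=
    prod_mono Icc_subset_Ici_self (subset_univ _)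
  obtain ⟨K, hK⟩ := (hu.mono hsub).exists_lipschitzOnWith one_ne_zero
    ((convex_Icc _ _).prod (convex_closedBall _ _))
    (isCompact_Icc.prod (isCompact_closedBall _ _))
  have hg : LipschitzOnWith (max 1 L) (fun t => (t, x t)) (Icc t₀ t) :=
    (LipschitzWith.id.lipschitzOnWith).prodMk hL
  have hm : MapsTo (fun t => (t, x t)) (Icc t₀ t) (Icc 0 t ×ˢ Metric.closedBall (0 : E n) C) :=
    fun s hs => ⟨⟨ht₀.trans hs.1, hs.2⟩, by simpa using hC s hs⟩
  have := hK.comp hg hm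
  refine LipschitzOnWith.absolutelyContinuousOnInterval (K := K * max 1 L) (this.mono ?_)
  rw [uIcc_of_le ht]
  exact Icc_subset_Icc_left hτ

end Trajectories

/-! ### Solutions of the interconnection -/

section Interconnection

variable {n k q m : ℕ} {D : Set (E q)} {f : ℝ → E n → E q → E n} {h : ℝ → E n → E k}
  {κ : ℝ → E m → E k → E m} {d : ℝ → E q} {t₀ : ℝ}

theorem IsSolution.fst_interconnection {x₀ : E n} {z₀ : E m} {w : ℝ → E n × E m}
    (hw : IsSolution (interconnection f h κ) d t₀ (x₀, z₀) w) :
    IsSolution f d t₀ x₀ fun t => (w t).1 := by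
  refine ⟨continuous_fst.comp_continuousOn hw.cont, fun t ht => ?_, fun t ht => ?_⟩
  · exact ⟨(hw.integrable t ht).1.fst, (hw.integrable t ht).2.fst⟩
  · have h1 := congrArg Prod.fst (hw.eq t ht)
    have h2 := (ContinuousLinearMap.fst ℝ (E n) (E m)).intervalIntegral_comp_comm
      (hw.integrable t ht)
    rw [Prod.fst_add] at h1
    rw [h1]
    congr 1
    exact h2.symm

theorem IsSolution.snd_interconnection {x₀ : E n} {z₀ : E m} {w : ℝ → E n × E m}
    (hw : IsSolution (interconnection f h κ) d t₀ (x₀, z₀) w) :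
    IsSolution (fun s z (_ : E q) => κ s z (h s (w s).1)) d t₀ z₀ fun t => (w t).2 := by
  refine ⟨continuous_snd.comp_continuousOn hw.cont, fun t ht => ?_, fun t ht => ?_⟩
  · exact ⟨(hw.integrable t ht).1.snd, (hw.integrable t ht).2.snd⟩
  · have h1 := congrArg Prod.snd (hw.eq t ht)
    have h2 := (ContinuousLinearMap.snd ℝ (E n) (E m)).intervalIntegral_comp_comm
      (hw.integrable t ht)
    rw [Prod.snd_add] at h1
    rw [h1]
    congr 1
    exact h2.symm

theorem IsSolution.prodMk_interconnection {x₀ : E n} {z₀ : E m} {x : ℝ → E n} {z : ℝ → E m}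
    (hx : IsSolution f d t₀ x₀ x)
    (hz : IsSolution (fun s z (_ : E q) => κ s z (h s (x s))) d t₀ z₀ z) :
    IsSolution (interconnection f h κ) d t₀ (x₀, z₀) fun t => (x t, z t) := by
  have hi : ∀ t, t₀ ≤ t → IntervalIntegrable
      (fun s => interconnection f h κ s (x s, z s) (d s)) volume t₀ t := fun t ht =>
    ⟨(hx.integrable t ht).1.prodMk (hz.integrable t ht).1,
      (hx.integrable t ht).2.prodMk (hz.integrable t ht).2⟩
  refine ⟨hx.cont.prodMk hz.cont, hi, fun t ht => ?_⟩
  refine Prod.ext ?_ ?_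
  · rw [Prod.fst_add]
    have h2 := (ContinuousLinearMap.fst ℝ (E n) (E m)).intervalIntegral_comp_comm (hi t ht)
    exact (hx.eq t ht).trans (congrArg (x₀ + ·) h2)
  · rw [Prod.snd_add]
    have h2 := (ContinuousLinearMap.snd ℝ (E n) (E m)).intervalIntegral_comp_comm (hi t ht)
    exact (hz.eq t ht).trans (congrArg (z₀ + ·) h2)

theorem integral_euclidean_apply {g : ℝ → E m} {a b : ℝ} (hg : IntervalIntegrable g volume a b)
    (c : Fin m) : (∫ s in a..b, g s) c = ∫ s in a..b, g s c :=
  ((EuclideanSpace.proj c : E m →L[ℝ] ℝ).intervalIntegral_comp_comm hg).symm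

end Interconnection

/-! ### Locally Lipschitz functions of the state -/

section LocallyLipschitz

variable {X Z : Type*} [NormedAddCommGroup X] [NormedAddCommGroup Z]

/-- `F` is bounded and Lipschitz in the state on compact sets, uniformly over bounded time intervals.
Unlike local Lipschitz continuity alone, this is stable under products. -/
def LocLipBdd (F : ℝ → X → ℝ) : Prop :=
  ∀ (T : ℝ) (S : Set X), IsCompact S → ∃ L M : ℝ, 0 ≤ L ∧ 0 ≤ M ∧ ∀ t ∈ Icc 0 T, ∀ x ∈ S,
    |F t x| ≤ M ∧ ∀ x' ∈ S, |F t x - F t x'| ≤ L * ‖x - x'‖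

theorem LocLipBdd.of_locLipState {F : ℝ → X → ℝ} (hF : LocLipState F) (hc : ContState F) :
    LocLipBdd F := by
  intro T S hS
  obtain ⟨L, hL⟩ := hF T S hS
  obtain ⟨M, hM⟩ := (isCompact_Icc.prod hS).exists_bound_of_continuousOn
    (hc.mono (prod_mono (Icc_subset_Ici_self : Icc 0 T ⊆ Ici 0) (subset_univ S)))
  refine ⟨L, max M 0, L.2, le_max_right _ _, fun t ht x hx => ⟨?_, fun x' hx' => ?_⟩⟩
  · exact (hM (t, x) ⟨ht, hx⟩).trans (le_max_left _ _)
  · have := (hL t ht).dist_le_mul x hx x' hx'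
    rwa [Real.dist_eq, dist_eq_norm] at this

theorem LocLipBdd.of_continuous {p : ℝ → ℝ} (hp : Continuous p) :
    LocLipBdd fun t (_ : X) => p t := by
  intro T S _
  obtain ⟨M, hM⟩ := isCompact_Icc.exists_bound_of_continuousOn (s := Icc 0 T) hp.continuousOn
  exact ⟨0, max M 0, le_rfl, le_max_right _ _, fun t ht x _ =>
    ⟨(hM t ht).trans (le_max_left _ _), fun x' _ => by simp⟩⟩

theorem LocLipBdd.comp_fst {F : ℝ → X → ℝ} (hF : LocLipBdd F) :
    LocLipBdd fun t (w : X × Z) => F t w.1 := by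
  intro T S hS
  obtain ⟨L, M, hL, hM, h⟩ := hF T (Prod.fst '' S) (hS.image continuous_fst)
  refine ⟨L, M, hL, hM, fun t ht w hw => ⟨(h t ht _ ⟨w, hw, rfl⟩).1, fun w' hw' =>
    ((h t ht _ ⟨w, hw, rfl⟩).2 _ ⟨w', hw', rfl⟩).trans ?_⟩⟩
  gcongr
  exact norm_fst_le (w - w')

theorem LocLipBdd.coord_snd {m : ℕ} (c : Fin m) : LocLipBdd fun _ (w : X × E m) => w.2 c := by
  intro T S hS
  obtain ⟨M, hM⟩ := hS.exists_bound_of_continuousOn (f := fun w => w) continuousOn_id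
  refine ⟨1, max M 0, zero_le_one, le_max_right _ _, fun t _ w hw => ⟨?_, fun w' _ => ?_⟩⟩
  · exact (PiLp.norm_apply_le w.2 c).trans
      ((norm_snd_le w).trans ((hM w hw).trans (le_max_left _ _)))
  · rw [one_mul]
    exact (PiLp.norm_apply_le (w.2 - w'.2) c).trans (norm_snd_le (w - w'))

theorem LocLipBdd.sub {F G : ℝ → X → ℝ} (hF : LocLipBdd F) (hG : LocLipBdd G) :
    LocLipBdd fun t x => F t x - G t x := by
  intro T S hS
  obtain ⟨L, M, hL, hM, h⟩ := hF T S hS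
  obtain ⟨L', M', hL', hM', h'⟩ := hG T S hS
  refine ⟨L + L', M + M', by positivity, by positivity, fun t ht x hx => ⟨?_, fun x' hx' => ?_⟩⟩
  · exact (abs_sub _ _).trans (add_le_add (h t ht x hx).1 (h' t ht x hx).1)
  · have h1 := (h t ht x hx).2 x' hx'
    have h2 := (h' t ht x hx).2 x' hx'
    have e : F t x - G t x - (F t x' - G t x') = (F t x - F t x') - (G t x - G t x') := by ring
    rw [e, add_mul]
    exact (abs_sub _ _).trans (add_le_add h1 h2)

theorem LocLipBdd.mul {F G : ℝ → X → ℝ} (hF : LocLipBdd F) (hG : LocLipBdd G) :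
    LocLipBdd fun t x => F t x * G t x := by
  intro T S hS
  obtain ⟨L, M, hL, hM, h⟩ := hF T S hS
  obtain ⟨L', M', hL', hM', h'⟩ := hG T S hS
  refine ⟨M * L' + L * M', M * M', by positivity, by positivity,
    fun t ht x hx => ⟨?_, fun x' hx' => ?_⟩⟩
  · rw [abs_mul]
    exact mul_le_mul (h t ht x hx).1 (h' t ht x hx).1 (abs_nonneg _) hM
  · have h1 := (h t ht x hx).2 x' hx'
    have h2 := (h' t ht x hx).2 x' hx'
    have e : F t x * G t x - F t x' * G t x' =
      F t x * (G t x - G t x') + (F t x - F t x') * G t x' := by ring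
    rw [e]
    refine (abs_add_le _ _).trans ?_
    rw [abs_mul, abs_mul]
    have h3 := (h t ht x hx).1
    have h4 := (h' t ht x' hx').1
    calc _ ≤ M * (L' * ‖x - x'‖) + L * ‖x - x'‖ * M' := by gcongr
      _ = _ := by ring

theorem LocLipState.of_coord {m : ℕ} {F : ℝ → X → Fin m → ℝ}
    (hF : ∀ c, LocLipBdd fun t x => F t x c) :
    LocLipState fun t x => (WithLp.toLp 2 (F t x) : E m) := by
  intro T S hS
  choose L M hL hM h using fun c => hF c T S hS
  have hp : ∀ t ∈ Icc 0 T, LipschitzOnWith (∑ c, ⟨L c, hL c⟩) (F t) S := by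
    intro t ht
    refine LipschitzOnWith.of_dist_le_mul fun x hx x' hx' => ?_
    refine (dist_pi_le_iff (by positivity)).2 fun c => ?_
    rw [Real.dist_eq, dist_eq_norm]
    refine ((h c t ht x hx).2 x' hx').trans ?_
    gcongr
    exact_mod_cast Finset.single_le_sum (f := fun c => (⟨L c, hL c⟩ : ℝ≥0))
      (fun _ _ => zero_le) (Finset.mem_univ c)
  exact ⟨_, fun t ht => (PiLp.lipschitzWith_toLp 2 fun _ : Fin m => ℝ).comp_lipschitzOnWith
    (hp t ht)⟩

end LocallyLipschitz

theorem ContState.comp_continuousOn {X Y Q : Type*} [TopologicalSpace X] [TopologicalSpace Y]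
    [TopologicalSpace Q] {G : ℝ → X → Y} (hG : ContState G) {A : Set Q} {T : Q → ℝ} {x : Q → X}
    (hT : ContinuousOn T A) (hT0 : ∀ a ∈ A, 0 ≤ T a) (hx : ContinuousOn x A) :
    ContinuousOn (fun a => G (T a) (x a)) A :=
  ContinuousOn.comp (f := fun a => (T a, x a)) hG (hT.prodMk hx)
    (fun a ha => ⟨hT0 a ha, mem_univ _⟩)

/-! ### The observer -/

section Cascade

/-- The successive estimates `ŷ₀ = y`, `ŷᵢ₊₁ = Pᵢ (ŷᵢ - zᵢ)` of a chain whose lowest member `y` is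
known, from the filter states `zᵢ` and the gains `Pᵢ`. -/
def cascade (P : ℕ → ℝ) (y : ℝ) (z : ℕ → ℝ) : ℕ → ℝ
  | 0 => y
  | i + 1 => P i * (cascade P y z i - z i)

/-- The equations of the cascade are solved one after the other, each of them being scalar and linear
in its own unknown. -/
theorem exists_cascade_solution {a y : ℝ → ℝ} {P b : ℕ → ℝ → ℝ} {t₀ : ℝ} (z₀ : ℕ → ℝ)
    (ha : ContinuousOn a (Ici t₀)) (hy : ContinuousOn y (Ici t₀))
    (hP : ∀ i, ContinuousOn (P i) (Ici t₀)) (hb : ∀ i, ContinuousOn (b i) (Ici t₀)) :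
    ∃ Z : ℕ → ℝ → ℝ, ∀ i, ContinuousOn (Z i) (Ici t₀) ∧ ∀ t, t₀ ≤ t → Z i t = z₀ i +
      ∫ s in t₀..t, (a s * cascade (fun i => P i s) (y s) (fun i => Z i s) (i + 1) - b i s) := by
  have hsol : ∀ (i : ℕ) (u : {u : ℝ → ℝ // ContinuousOn u (Ici t₀)}), ∃ z : ℝ → ℝ,
      ContinuousOn z (Ici t₀) ∧ ∀ t, t₀ ≤ t → z t = z₀ i +
        ∫ s in t₀..t, ((a s * (P i s * u.1 s) - b i s) - a s * P i s * z s) := by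
    intro i u
    have := hP i
    have := hb i
    have := u.2
    exact exists_linear_ode_solution (z₀ i) (by fun_prop) (by fun_prop)
  choose z hz hzeq using hsol
  let Yh : ℕ → {u : ℝ → ℝ // ContinuousOn u (Ici t₀)} := fun i => Nat.rec ⟨y, hy⟩
    (fun i u => ⟨fun s => P i s * (u.1 s - z i u s), (hP i).mul (u.2.sub (hz i u))⟩) i
  have hYh : ∀ i s, cascade (fun i => P i s) (y s) (fun i => z i (Yh i) s) i = (Yh i).1 s := by
    intro i s
    induction i with
    | zero => rfl
    | succ i ih => rw [cascade, ih]
  refine ⟨fun i => z i (Yh i), fun i => ⟨hz i _, fun t ht => ?_⟩⟩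
  change z i (Yh i) t = _
  rw [hzeq i (Yh i) t ht]
  congr 1
  refine intervalIntegral.integral_congr fun s _ => ?_
  simp only [cascade, hYh]
  ring

end Cascade

section Observer

variable {n k q : ℕ} {D : Set (E q)} {f : ℝ → E n → E q → E n} {h : ℝ → E n → E k}
  (F : OutputFamily D f h) {M : ℕ} (e : (Σ j : Fin F.p, Fin (F.m j)) ≃ Fin M)
  (P : Fin F.p → ℕ → ℝ → ℝ)

namespace OutputFamily

/-- The filter state for `y_{i,j}`, with the junk value `0` for `i ≥ m_j`; the bijection `e` numbers
the pairs `(j, i)`. -/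
def coord (z : E M) (j : Fin F.p) (i : ℕ) : ℝ :=
  if hi : i < F.m j then z (e ⟨j, ⟨i, hi⟩⟩) else 0

/-- The estimate of `y_{i,j}` from the output `y` and the observer state `z`, with gains `P j i t`. -/
def estimate (j : Fin F.p) (i : ℕ) (t : ℝ) (y : E k) (z : E M) : ℝ :=
  cascade (fun i => P j i t) (F.g j t y) (F.coord e z j) i

/-- The right-hand side `κ` of the observer, a copy of the equations for the `y_{i,j}` with `i < m_j`
in which `y_{i+1,j}` is replaced by its estimate. -/
noncomputable def observer (t : ℝ) (z : E M) (y : E k) : E M :=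
  WithLp.toLp 2 fun c =>
    F.a (e.symm c).1 t y * F.estimate e P (e.symm c).1 ((e.symm c).2 + 1) t y z
      - F.inj (e.symm c).1 ((e.symm c).2 + 1) t y

/-- The estimate of `𝒟y`. -/
noncomputable def estimates (t : ℝ) (y : E k) (z : E M) : F.Space :=
  WithLp.toLp 2 fun c => F.estimate e P c.1 (c.2 + 1) t y z

theorem coord_of_lt (z : E M) {j : Fin F.p} {i : ℕ} (hi : i < F.m j) :
    F.coord e z j i = z (e ⟨j, ⟨i, hi⟩⟩) := dif_pos hi

theorem abs_coord_le (z : E M) (j : Fin F.p) (i : ℕ) : |F.coord e z j i| ≤ ‖z‖ := by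
  unfold coord
  split_ifs with hi
  · exact PiLp.norm_apply_le z _
  · simp

theorem continuous_coord (j : Fin F.p) (i : ℕ) : Continuous fun z => F.coord e z j i := by
  unfold coord
  split_ifs with hi <;> fun_prop

variable {P}

theorem continuousOn_estimate (hP : ∀ j i, Continuous (P j i)) {Q : Type*} [TopologicalSpace Q]
    {A : Set Q} {T : Q → ℝ} {y : Q → E k} {z : Q → E M} (hT : ContinuousOn T A)
    (hT0 : ∀ a ∈ A, 0 ≤ T a) (hy : ContinuousOn y A) (hz : ContinuousOn z A) (j : Fin F.p)
    (i : ℕ) : ContinuousOn (fun a => F.estimate e P j i (T a) (y a) (z a)) A := by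
  induction i with
  | zero => exact (F.g_cont j).comp_continuousOn hT hT0 hy
  | succ i ih =>
    exact ((hP j i).comp_continuousOn hT).mul
      (ih.sub ((F.continuous_coord e j i).comp_continuousOn hz))

theorem continuousOn_observer (hP : ∀ j i, Continuous (P j i)) {Q : Type*} [TopologicalSpace Q]
    {A : Set Q} {T : Q → ℝ} {y : Q → E k} {z : Q → E M} (hT : ContinuousOn T A)
    (hT0 : ∀ a ∈ A, 0 ≤ T a) (hy : ContinuousOn y A) (hz : ContinuousOn z A) :
    ContinuousOn (fun a => F.observer e P (T a) (z a) (y a)) A := by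
  refine (PiLp.continuous_toLp 2 _).comp_continuousOn (continuousOn_pi.2 fun c => ?_)
  exact (((F.a_cont _).comp_continuousOn hT hT0 hy).mul
    (F.continuousOn_estimate e hP hT hT0 hy hz _ _)).sub
    ((F.inj_cont _ _ (by omega) (e.symm c).2.2).comp_continuousOn hT hT0 hy)

theorem continuousOn_estimates (hP : ∀ j i, Continuous (P j i)) {Q : Type*} [TopologicalSpace Q]
    {A : Set Q} {T : Q → ℝ} {y : Q → E k} {z : Q → E M} (hT : ContinuousOn T A)
    (hT0 : ∀ a ∈ A, 0 ≤ T a) (hy : ContinuousOn y A) (hz : ContinuousOn z A) :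
    ContinuousOn (fun a => F.estimates e P (T a) (y a) (z a)) A :=
  (PiLp.continuous_toLp 2 _).comp_continuousOn
    (continuousOn_pi.2 fun _ => F.continuousOn_estimate e hP hT hT0 hy hz _ _)

theorem estimate_zero (j : Fin F.p) (i : ℕ) {t : ℝ} (ht : 0 ≤ t) :
    F.estimate e P j i t 0 0 = 0 := by
  have hc : ∀ i, F.coord e 0 j i = 0 := fun i => by
    have := F.abs_coord_le e 0 j i
    simpa using this
  induction i with
  | zero => exact F.g_zero j t ht
  | succ i ih =>
    change P j i t * (F.estimate e P j i t 0 0 - F.coord e 0 j i) = 0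
    rw [ih, hc, sub_self, mul_zero]

theorem estimates_zero {t : ℝ} (ht : 0 ≤ t) : F.estimates e P t 0 0 = 0 := by
  ext c
  exact F.estimate_zero e _ _ ht

theorem observer_zero {t : ℝ} (ht : 0 ≤ t) : F.observer e P t 0 0 = 0 := by
  ext c
  simp only [observer, F.estimate_zero e _ _ ht]
  rw [F.inj_zero _ _ (by omega) (e.symm c).2.2 t ht]
  simp

theorem contZero_observer (hP : ∀ j i, Continuous (P j i)) : ContZero (F.observer e P) :=
  ⟨F.continuousOn_observer e hP continuousOn_fst (fun _ ha => ha.1) (by fun_prop) (by fun_prop),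
    fun _ ht => F.observer_zero e ht⟩

theorem locLipBdd_y {j : Fin F.p} {i : ℕ} (hi : i ≤ F.m j) : LocLipBdd (F.y j i) := by
  refine LocLipBdd.of_locLipState (fun T S hS => ?_) (F.y_smooth j i hi).continuousOn
  obtain ⟨C, hC⟩ := hS.isBounded.subset_closedBall 0
  obtain ⟨L, hL⟩ := ((F.y_smooth j i hi).mono (prod_mono (Icc_subset_Ici_self : Icc 0 T ⊆ Ici 0)
    (subset_univ (Metric.closedBall (0 : E n) C)))).exists_lipschitzOnWith one_ne_zero
    ((convex_Icc _ _).prod (convex_closedBall _ _))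
    (isCompact_Icc.prod (isCompact_closedBall _ _))
  refine ⟨L, fun t ht => LipschitzOnWith.of_dist_le_mul fun x hx x' hx' => ?_⟩
  have := hL.dist_le_mul (t, x) ⟨ht, hC hx⟩ (t, x') ⟨ht, hC hx'⟩
  simpa [Prod.dist_eq] using this

theorem locLipBdd_g (j : Fin F.p) : LocLipBdd fun t x => F.g j t (h t x) := by
  intro T S hS
  obtain ⟨L, M, hL, hM, H⟩ := F.locLipBdd_y (Nat.zero_le (F.m j)) T S hS
  refine ⟨L, M, hL, hM, fun t ht x hx => ?_⟩
  have := H t ht x hx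
  simp only [F.y_zero j t ht.1] at this
  exact this

theorem contState_output (hh : ContState h) {G : ℝ → E k → ℝ} (hG : ContState G) :
    ContState fun t x => G t (h t x) :=
  hG.comp_continuousOn continuousOn_fst (fun _ ha => ha.1) hh

theorem locLipBdd_estimate (hP : ∀ j i, Continuous (P j i)) (j : Fin F.p) (i : ℕ) :
    LocLipBdd fun t (w : E n × E M) => F.estimate e P j i t (h t w.1) w.2 := by
  induction i with
  | zero => exact (F.locLipBdd_g j).comp_fst
  | succ i ih =>
    have hc : LocLipBdd fun _ (w : E n × E M) => F.coord e w.2 j i := by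
      unfold coord
      split_ifs with hi
      · exact LocLipBdd.coord_snd _
      · exact LocLipBdd.of_continuous continuous_const
    exact (LocLipBdd.of_continuous (hP j i)).mul (ih.sub hc)

theorem locLipState_observer (hh : ContState h) (hP : ∀ j i, Continuous (P j i)) :
    LocLipState fun t (w : E n × E M) => F.observer e P t w.2 (h t w.1) := by
  refine LocLipState.of_coord fun c => ?_
  refine LocLipBdd.sub (LocLipBdd.mul ?_ (F.locLipBdd_estimate e hP _ _)) ?_
  · exact (LocLipBdd.of_locLipState (F.a_lip _) (contState_output hh (F.a_cont _))).comp_fst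
  · exact (LocLipBdd.of_locLipState (F.inj_lip _ _ (by omega) (e.symm c).2.2)
      (contState_output hh (F.inj_cont _ _ (by omega) (e.symm c).2.2))).comp_fst

theorem exists_abs_estimate_le (hP : ∀ j i, Continuous (P j i)) (T C : ℝ) (j : Fin F.p) (i : ℕ) :
    ∃ K, 0 ≤ K ∧ ∀ t ∈ Icc 0 T, ∀ y, ‖y‖ ≤ C → ∀ z, |F.estimate e P j i t y z| ≤ K * ‖z‖ + K := by
  induction i with
  | zero =>
    obtain ⟨K, hK, H⟩ := (F.g_cont j).exists_bound T C
    exact ⟨K, hK, fun t ht y hy z => (H t ht y hy).trans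
      (le_add_of_nonneg_left (mul_nonneg hK (norm_nonneg _)))⟩
  | succ i ih =>
    obtain ⟨K, hK, H⟩ := ih
    obtain ⟨p, hp⟩ := isCompact_Icc.exists_bound_of_continuousOn (s := Icc 0 T)
      (hP j i).continuousOn
    refine ⟨max p 0 * (K + 1), by positivity, fun t ht y hy z => ?_⟩
    change |P j i t * (F.estimate e P j i t y z - F.coord e z j i)| ≤ _
    rw [abs_mul]
    have h1 : |P j i t| ≤ max p 0 := (hp t ht).trans (le_max_left _ _)
    have h2 : |F.estimate e P j i t y z - F.coord e z j i| ≤ (K * ‖z‖ + K) + ‖z‖ :=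
      (abs_sub _ _).trans (add_le_add (H t ht y hy z) (F.abs_coord_le e z j i))
    calc _ ≤ max p 0 * ((K * ‖z‖ + K) + ‖z‖) := by gcongr
      _ ≤ max p 0 * ((K + 1) * ‖z‖ + (K + 1)) :=
        mul_le_mul_of_nonneg_left (by linarith) (le_max_right _ _)
      _ = _ := by ring

theorem exists_norm_observer_le (hP : ∀ j i, Continuous (P j i)) (T C : ℝ) :
    ∃ K, 0 ≤ K ∧ ∀ t ∈ Icc 0 T, ∀ y, ‖y‖ ≤ C → ∀ z, ‖F.observer e P t z y‖ ≤ K * ‖z‖ + K := by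
  have hc : ∀ c : Fin M, ∃ K, 0 ≤ K ∧ ∀ t ∈ Icc 0 T, ∀ y, ‖y‖ ≤ C → ∀ z,
      |F.observer e P t z y c| ≤ K * ‖z‖ + K := by
    intro c
    obtain ⟨K, hK, H⟩ := F.exists_abs_estimate_le e hP T C (e.symm c).1 ((e.symm c).2 + 1)
    obtain ⟨A, hA, HA⟩ := (F.a_cont (e.symm c).1).exists_bound T C
    obtain ⟨B, hB, HB⟩ := (F.inj_cont (e.symm c).1 ((e.symm c).2 + 1) (by omega)
      (e.symm c).2.2).exists_bound T C
    refine ⟨A * K + B, by positivity, fun t ht y hy z => ?_⟩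
    refine (abs_sub _ _).trans ?_
    rw [abs_mul]
    calc _ ≤ A * (K * ‖z‖ + K) + B := add_le_add
          (mul_le_mul (HA t ht y hy) (H t ht y hy z) (abs_nonneg _) hA) (HB t ht y hy)
      _ ≤ _ := by nlinarith [mul_nonneg hB (norm_nonneg z)]
  choose K hK H using hc
  have hKs : 0 ≤ ∑ c, K c := Finset.sum_nonneg fun c _ => hK c
  have hlip := PiLp.lipschitzWith_toLp 2 fun _ : Fin M => ℝ
  set N : ℝ≥0 := (Fintype.card (Fin M) : ℝ≥0) ^ (1 / (2 : ENNReal)).toReal with hN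
  refine ⟨N * ∑ c, K c, by positivity, fun t ht y hy z => ?_⟩
  have h1 := hlip.dist_le_mul (WithLp.ofLp (F.observer e P t z y)) 0
  rw [WithLp.toLp_ofLp, WithLp.toLp_zero, dist_zero_right, dist_zero_right] at h1
  refine h1.trans ?_
  have h2 : ‖WithLp.ofLp (F.observer e P t z y)‖ ≤ (∑ c, K c) * ‖z‖ + ∑ c, K c := by
    refine (pi_norm_le_iff_of_nonneg (by positivity)).2 fun c => (H c t ht y hy z).trans ?_
    have := Finset.single_le_sum (f := K) (fun c _ => hK c) (Finset.mem_univ c)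
    gcongr
  calc _ ≤ (N : ℝ) * ((∑ c, K c) * ‖z‖ + ∑ c, K c) := by gcongr
    _ = _ := by ring

theorem exists_observer_solution (hsys : IsSystem D f h) (hP : ∀ j i, Continuous (P j i))
    {d : ℝ → E q} {t₀ : ℝ} (ht₀ : 0 ≤ t₀) {x : ℝ → E n} (hx : ContinuousOn x (Ici t₀))
    (z₀ : E M) : ∃ z : ℝ → E M,
      IsSolution (fun s z (_ : E q) => F.observer e P s z (h s (x s))) d t₀ z₀ z := by
  have hpos : ∀ s ∈ Ici t₀, (0 : ℝ) ≤ s := fun s hs => ht₀.trans hs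
  have hy : ContinuousOn (fun s => h s (x s)) (Ici t₀) :=
    hsys.h_cont.comp_continuousOn continuousOn_id hpos hx
  let b : Fin F.p → ℕ → ℝ → ℝ := fun j i s => if i < F.m j then F.inj j (i + 1) s (h s (x s)) else 0
  have hb : ∀ j i, ContinuousOn (b j i) (Ici t₀) := by
    intro j i
    by_cases hi : i < F.m j
    · simp only [b, if_pos hi]
      exact (F.inj_cont j (i + 1) (by omega) hi).comp_continuousOn continuousOn_id hpos hy
    · simp only [b, if_neg hi]
      exact continuousOn_const
  choose Z hZ using fun j => exists_cascade_solution (F.coord e z₀ j)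
    ((F.a_cont j).comp_continuousOn continuousOn_id hpos hy)
    ((F.g_cont j).comp_continuousOn continuousOn_id hpos hy)
    (fun i => (hP j i).continuousOn) (hb j)
  let z : ℝ → E M := fun t => WithLp.toLp 2 fun c => Z (e.symm c).1 (e.symm c).2 t
  have hz : ContinuousOn z (Ici t₀) := (PiLp.continuous_toLp 2 _).comp_continuousOn
    (continuousOn_pi.2 fun c => (hZ _ _).1)
  have hκ : ContinuousOn (fun s => F.observer e P s (z s) (h s (x s))) (Ici t₀) :=
    F.continuousOn_observer e hP continuousOn_id hpos hy hz
  have hi : ∀ t, t₀ ≤ t →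
      IntervalIntegrable (fun s => F.observer e P s (z s) (h s (x s))) volume t₀ t := by
    intro t ht
    refine (hκ.mono ?_).intervalIntegrable
    rw [uIcc_of_le ht]
    exact Icc_subset_Ici_self
  -- The estimates built from `z` only see the coordinates below them.
  have hest : ∀ j i s, i ≤ F.m j → F.estimate e P j i s (h s (x s)) (z s) =
      cascade (fun i => P j i s) (F.g j s (h s (x s))) (fun i => Z j i s) i := by
    intro j i s hi
    induction i with
    | zero => rfl
    | succ i ih =>
      change P j i s * (F.estimate e P j i s (h s (x s)) (z s) - F.coord e (z s) j i) = _
      rw [ih (by omega), F.coord_of_lt e _ (show i < F.m j from hi)]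
      change P j i s * (_ - Z (e.symm (e ⟨j, ⟨i, hi⟩⟩)).1 (e.symm (e ⟨j, ⟨i, hi⟩⟩)).2 s) = _
      rw [Equiv.symm_apply_apply]
      rfl
  refine ⟨z, hz, hi, fun t ht => ?_⟩
  ext c
  rw [PiLp.add_apply, integral_euclidean_apply (hi t ht)]
  change Z (e.symm c).1 (e.symm c).2 t = _
  rw [(hZ _ _).2 t ht, F.coord_of_lt e _ (e.symm c).2.2]
  congr 1
  · simp
  · refine intervalIntegral.integral_congr fun s _ => ?_
    simp only [observer]
    rw [hest _ _ s (e.symm c).2.2]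
    simp [b]

/-- The interconnection with the observer is robustly forward complete for arbitrary continuous
gains, because the observer is affine in its state. -/
theorem rfc_interconnection_observer (hsys : IsSystem D f h) (hrfc : RFC D f)
    (hP : ∀ j i, Continuous (P j i)) : RFC D (interconnection f h (F.observer e P)) := by
  refine ⟨?_, ?_⟩
  · rintro t₀ ht₀ ⟨x₀, z₀⟩ d hd
    obtain ⟨x, hx⟩ := hrfc.exists_solution t₀ ht₀ x₀ d hd
    obtain ⟨z, hz⟩ := F.exists_observer_solution e hsys hP (d := d) ht₀ hx.cont z₀
    exact ⟨_, hx.prodMk_interconnection hz⟩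
  · intro T hT r hr
    obtain ⟨C, hC⟩ := hrfc.bounded T hT r hr
    obtain ⟨B, -, hB⟩ := hsys.h_cont.exists_bound (T + T) C
    obtain ⟨K, hK, H⟩ := F.exists_norm_observer_le e hP (T + T) B
    refine ⟨max C (gronwallBound r K K T), ?_⟩
    rintro t₀ ht₀ ⟨x₀, z₀⟩ hw₀ d hd w hw s hs
    have hx₀ : ‖x₀‖ ≤ r := (norm_fst_le (x₀, z₀)).trans hw₀
    have hz₀ : ‖z₀‖ ≤ r := (norm_snd_le (x₀, z₀)).trans hw₀
    have hxs := hw.fst_interconnection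
    have hzs := hw.snd_interconnection
    have hx := hC t₀ ht₀ x₀ hx₀ d hd _ hxs
    have hbd : ∀ r ∈ Icc t₀ (t₀ + s),
        ‖F.observer e P r (w r).2 (h r (w r).1)‖ ≤ K * ‖(w r).2‖ + K := by
      intro r hr
      have hr0 : 0 ≤ r := ht₀.1.trans hr.1
      have hrT : r ≤ T + T := by linarith [hr.2, hs.2, ht₀.2]
      have := hx (r - t₀) ⟨by linarith [hr.1], by linarith [hr.2, hs.2]⟩
      rw [add_sub_cancel] at this
      exact H r ⟨hr0, hrT⟩ _ (hB r ⟨hr0, hrT⟩ _ this) _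
    have h1 := hzs.norm_le_gronwallBound hK hbd (t := t₀ + s) ⟨by linarith [hs.1], le_rfl⟩
    rw [add_sub_cancel_left] at h1
    refine max_le ((hx s hs).trans (le_max_left _ _)) (h1.trans (le_trans ?_ (le_max_right _ _)))
    exact (gronwallBound_mono (norm_nonneg _) hK hK hs.2).trans (by
      have : ∀ δ, gronwallBound δ K K T = δ * Real.exp (K * T) + gronwallBound 0 K K T := by
        intro δ
        unfold gronwallBound
        split_ifs with h0 <;> simp [h0]
      rw [this ‖z₀‖, this r]
      gcongr)

theorem exists_linear_bound_interconnection (hsys : IsSystem D f h)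
    (hP : ∀ j i, Continuous (P j i)) (T C : ℝ) : ∃ L : ℝ, 0 ≤ L ∧ ∀ t ∈ Icc 0 T,
      ∀ w : E n × E M, ‖w‖ ≤ C → ∀ d ∈ D,
        ‖interconnection f h (F.observer e P) t w d‖ ≤ L * ‖w‖ := by
  obtain ⟨L₁, h₁⟩ := hsys.f_lip T _ (isCompact_closedBall (0 : E n) (max C 0))
  obtain ⟨L₂, h₂⟩ := F.locLipState_observer e hsys.h_cont hP T _
    (isCompact_closedBall (0 : E n × E M) (max C 0))
  refine ⟨max L₁ L₂, by positivity, fun t ht w hw d hd => ?_⟩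
  have hw' : ‖w‖ ≤ max C 0 := hw.trans (le_max_left _ _)
  have e₁ := (h₁ t ht d hd).dist_le_mul w.1 (by simpa using (norm_fst_le w).trans hw') 0 (by simp)
  have e₂ := (h₂ t ht).dist_le_mul w (by simpa using hw') 0 (by simp)
  rw [hsys.f_zero t ht.1 d hd, dist_zero_right, dist_zero_right] at e₁
  simp only [Prod.fst_zero, Prod.snd_zero, hsys.h_zero t ht.1, F.observer_zero e ht.1,
    dist_zero_right] at e₂
  refine max_le (e₁.trans ?_) (e₂.trans ?_)
  · exact mul_le_mul (le_max_left _ _) (norm_fst_le w) (norm_nonneg _) (by positivity)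
  · gcongr
    exact le_max_right _ _

end OutputFamily

end Observer

/-! ### Convergence of the observer -/

section Convergence

variable {n k q : ℕ} {D : Set (E q)} {f : ℝ → E n → E q → E n} {h : ℝ → E n → E k}
  (F : OutputFamily D f h) {M : ℕ} (e : (Σ j : Fin F.p, Fin (F.m j)) ≃ Fin M)

namespace OutputFamily

theorem exists_derivative_bound (hsys : IsSystem D f h) (T C : ℝ) (j : Fin F.p) :
    ∃ ρ : ℝ, 0 ≤ ρ ∧ ∀ i ≤ F.m j, ∀ t ∈ Icc 0 T, ∀ x, ‖x‖ ≤ C → |F.y j i t x| ≤ ρ ∧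
      ∀ d ∈ D, |fderivWithin ℝ (fun u : ℝ × E n => F.y j i u.1 u.2) (Ici 0 ×ˢ univ) (t, x)
        (1, f t x d)| ≤ ρ := by
  have hone : ∀ i, ∃ ρ : ℝ, i ≤ F.m j → ∀ t ∈ Icc 0 T, ∀ x, ‖x‖ ≤ C → |F.y j i t x| ≤ ρ ∧
      ∀ d ∈ D, |fderivWithin ℝ (fun u : ℝ × E n => F.y j i u.1 u.2) (Ici 0 ×ˢ univ) (t, x)
        (1, f t x d)| ≤ ρ := by
    intro i
    by_cases hi : i ≤ F.m j
    swap
    · exact ⟨0, fun h => absurd h hi⟩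
    have hs := F.y_smooth j i hi
    have huniq : UniqueDiffOn ℝ (Ici (0 : ℝ) ×ˢ (univ : Set (E n))) :=
      (uniqueDiffOn_Ici 0).prod uniqueDiffOn_univ
    obtain ⟨ρ₁, -, h₁⟩ := ContState.exists_bound (G := F.y j i) hs.continuousOn T C
    obtain ⟨ρ₂, h₂⟩ := (isCompact_Icc.prod
      (isCompact_closedBall (0 : E n) C)).exists_bound_of_continuousOn
      ((hs.continuousOn_fderivWithin huniq le_rfl).mono
        (prod_mono (Icc_subset_Ici_self : Icc 0 T ⊆ Ici 0) (subset_univ _)))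
    obtain ⟨ρ₃, hρ₃, h₃⟩ := hsys.exists_bound T C
    refine ⟨max ρ₁ (ρ₂ * max 1 ρ₃), fun _ t ht x hx => ⟨(h₁ t ht x hx).trans (le_max_left _ _),
      fun d hd => le_trans ?_ (le_max_right _ _)⟩⟩
    have h2 := h₂ (t, x) ⟨ht, by simpa using hx⟩
    refine ((fderivWithin ℝ (fun u : ℝ × E n => F.y j i u.1 u.2) (Ici 0 ×ˢ univ)
      (t, x)).le_opNorm _).trans ?_
    refine mul_le_mul h2 ?_ (norm_nonneg _) ((norm_nonneg _).trans h2)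
    rw [Prod.norm_def]
    exact max_le_max (by simp) (h₃ t ht x hx d hd)
  choose ρ hρ using hone
  obtain ⟨R, hR⟩ := ((Finset.range (F.m j + 1)).image ρ).exists_le
  refine ⟨max R 0, le_max_right _ _, fun i hi t ht x hx => ?_⟩
  have hle : ρ i ≤ max R 0 := (hR _ (Finset.mem_image_of_mem ρ
    (Finset.mem_range.2 (by omega)))).trans (le_max_left _ _)
  exact ⟨(hρ i hi t ht x hx).1.trans hle, fun d hd => ((hρ i hi t ht x hx).2 d hd).trans hle⟩

/-- Uniform continuity of `φ Ψ` near the graph of `𝒟y` over compact sets. -/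
theorem exists_modulus (hh : ContState h) {l : ℕ} {Ψ : ℝ → E k → F.Space → E l}
    (hΨ : ContZero Ψ) {φ : ℝ → ℝ} (hφ : KPlus φ) (T C : ℝ) {ε : ℝ} (hε : 0 < ε) :
    ∃ δ > 0, ∀ t ∈ Icc 0 T, ∀ x, ‖x‖ ≤ C → ∀ v : F.Space,
      (∀ c : Σ j : Fin F.p, Fin (F.m j), |v c - F.y c.1 (c.2 + 1) t x| ≤ δ) →
        φ t * ‖Ψ t (h t x) v - Ψ t (h t x) (F.Dy t x)‖ ≤ ε := by
  obtain ⟨B, hB0, hB⟩ := hh.exists_bound T C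
  have hy : ∀ c : Σ j : Fin F.p, Fin (F.m j), ∃ ρ, 0 ≤ ρ ∧ ∀ t ∈ Icc 0 T, ∀ x, ‖x‖ ≤ C →
      |F.y c.1 (c.2 + 1) t x| ≤ ρ := fun c =>
    ContState.exists_bound (G := F.y c.1 (c.2 + 1)) (F.y_smooth _ _ c.2.2).continuousOn T C
  choose ρ hρ0 hρ using hy
  have hρs : 0 ≤ ∑ c, ρ c := Finset.sum_nonneg fun c _ => hρ0 c
  set R := ∑ c, ρ c + 1 with hR
  let H : ℝ × E k × ((Σ j : Fin F.p, Fin (F.m j)) → ℝ) → E l :=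
    fun p => φ p.1 • Ψ p.1 p.2.1 (WithLp.toLp 2 p.2.2)
  set A : Set (ℝ × E k × ((Σ j : Fin F.p, Fin (F.m j)) → ℝ)) :=
    Icc 0 T ×ˢ Metric.closedBall 0 B ×ˢ Metric.closedBall 0 R with hA
  have hAc : IsCompact A :=
    isCompact_Icc.prod ((isCompact_closedBall _ _).prod (isCompact_closedBall _ _))
  have hH : ContinuousOn H A := by
    refine ContinuousOn.smul (hφ.cont.comp continuousOn_fst fun p hp => hp.1.1) ?_
    exact hΨ.cont.comp (f := fun p : ℝ × E k × ((Σ j : Fin F.p, Fin (F.m j)) → ℝ) =>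
      (p.1, p.2.1, (WithLp.toLp 2 p.2.2 : F.Space)))
      (by fun_prop) (fun p hp => ⟨hp.1.1, mem_univ _⟩)
  obtain ⟨δ, hδ, hu⟩ := Metric.uniformContinuousOn_iff.1
    (hAc.uniformContinuousOn_of_continuous hH) ε hε
  refine ⟨min (δ / 2) 1, lt_min (half_pos hδ) one_pos, fun t ht x hx v hv => ?_⟩
  have hv0 : ∀ c : Σ j : Fin F.p, Fin (F.m j), |F.y c.1 (c.2 + 1) t x| ≤ R - 1 := fun c => by
    have := Finset.single_le_sum (f := ρ) (fun c _ => hρ0 c) (Finset.mem_univ c)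
    linarith [hρ c t ht x hx]
  have hvR : ∀ c, |v c| ≤ R := fun c => by
    have h1 := abs_sub_abs_le_abs_sub (v c) (F.y c.1 (c.2 + 1) t x)
    have h2 := (hv c).trans (min_le_right _ _)
    linarith [hv0 c]
  have hR0 : 0 ≤ R := by positivity
  have h1 := hu (t, h t x, WithLp.ofLp v)
    ⟨ht, by simpa using hB t ht x hx, by
      simpa using (pi_norm_le_iff_of_nonneg hR0).2 hvR⟩
    (t, h t x, WithLp.ofLp (F.Dy t x))
    ⟨ht, by simpa using hB t ht x hx, by
      simpa using (pi_norm_le_iff_of_nonneg hR0).2 fun c => (hv0 c).trans (by linarith)⟩ (by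
      rw [Prod.dist_eq, Prod.dist_eq, dist_self, dist_self]
      refine max_lt hδ (max_lt hδ ((dist_pi_lt_iff hδ).2 fun c => ?_))
      rw [Real.dist_eq]
      have := (hv c).trans (min_le_left _ _)
      exact this.trans_lt (half_lt_self hδ))
  simp only [H, WithLp.toLp_ofLp, dist_eq_norm, ← smul_sub, norm_smul, Real.norm_eq_abs,
    abs_of_pos (hφ.pos t ht.1)] at h1
  exact h1.le

theorem observer_apply (P : Fin F.p → ℕ → ℝ → ℝ) (t : ℝ) (z : E M) (y : E k) {j : Fin F.p} {i : ℕ}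
    (hi : i < F.m j) : F.observer e P t z y (e ⟨j, ⟨i, hi⟩⟩) =
      F.a j t y * F.estimate e P j (i + 1) t y z - F.inj j (i + 1) t y := by
  simp only [observer]
  rw [e.symm_apply_apply]

/-- The recursion for `y_{i,j}`, solved for the derivative of `y_{i,j}` along the vector field. -/
theorem fderivWithin_y_eq {j : Fin F.p} {i : ℕ} (hi : i < F.m j) {c t : ℝ} (hc : 0 < c)
    (ha : ∀ t, 0 ≤ t → ∀ v, c ≤ F.a j t v) (ht : 0 ≤ t) {d : E q} (hd : d ∈ D) (x : E n) :
    fderivWithin ℝ (fun u : ℝ × E n => F.y j i u.1 u.2) (Ici 0 ×ˢ univ) (t, x) (1, f t x d) =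
      F.a j t (h t x) * F.y j (i + 1) t x - F.inj j (i + 1) t (h t x) := by
  have h0 : F.a j t (h t x) ≠ 0 := (hc.trans_le (ha t ht _)).ne'
  rw [F.y_succ j i hi t ht x d hd, ← mul_assoc, mul_one_div_cancel h0]
  ring

/-- One level of the cascade: if the estimate of `y_{i,j}` is eventually accurate up to `s³ / 8`,
that of `y_{i+1,j}` is eventually accurate up to `2 s`. The smallness of `s t` is relative to bounds
`ρ N` which are valid for `‖x‖ ≤ B N`, and every solution satisfies `‖x t‖ ≤ B ⌈t⌉₊` from some time
on. -/
theorem uniformlyEventually_abs_estimate_succ_sub_le (hsys : IsSystem D f h) (hrfc : RFC D f)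
    {B : ℕ → ℝ} (hB : ∀ N : ℕ, ∀ t₀ ∈ Icc (0 : ℝ) N, ∀ x₀ : E n, ‖x₀‖ ≤ N →
      ∀ d ∈ Disturbances D, ∀ x, IsSolution f d t₀ x₀ x → ∀ s ∈ Icc (0 : ℝ) N, ‖x (t₀ + s)‖ ≤ B N)
    {j : Fin F.p} {ρ : ℕ → ℝ} {c : ℝ} (hc : 0 < c) (ha : ∀ t, 0 ≤ t → ∀ v, c ≤ F.a j t v)
    (hρ : ∀ N : ℕ, ∀ i ≤ F.m j, ∀ t ∈ Icc (0 : ℝ) N, ∀ x, ‖x‖ ≤ B N → |F.y j i t x| ≤ ρ N ∧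
      ∀ d ∈ D, |fderivWithin ℝ (fun u : ℝ × E n => F.y j i u.1 u.2) (Ici 0 ×ˢ univ) (t, x)
        (1, f t x d)| ≤ ρ N)
    {s : ℝ → ℝ} (hs : ContDiff ℝ 1 s) (hs0 : ∀ t, 0 < s t) (hs1 : ∀ t, s t ≤ 1)
    (hsρ : ∀ t, s t * ρ ⌈t⌉₊ ≤ c / 32) (hds : ∀ t, |deriv s t| ≤ c / 32)
    (hdsρ : ∀ t, |deriv s t| * ρ ⌈t⌉₊ ≤ c / 32)
    {P : Fin F.p → ℕ → ℝ → ℝ} (hP : ∀ j i, Continuous (P j i)) {i : ℕ} (hi : i < F.m j)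
    (hPs : ∀ t, P j i t = (s t)⁻¹ ^ 2)
    (hprev : UniformlyEventually D (interconnection f h (F.observer e P)) fun t w =>
      |F.estimate e P j i t (h t w.1) w.2 - F.y j i t w.1| ≤ s t ^ 3 / 8) :
    UniformlyEventually D (interconnection f h (F.observer e P)) fun t w =>
      |F.estimate e P j (i + 1) t (h t w.1) w.2 - F.y j (i + 1) t w.1| ≤ 2 * s t := by
  intro T R
  obtain ⟨τ₀, hτ₀⟩ := hprev T R
  obtain ⟨τ, hτ0, hτT, hτR, hττ₀⟩ : ∃ τ : ℝ, 0 ≤ τ ∧ T ≤ τ ∧ R ≤ τ ∧ τ₀ ≤ τ :=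
    ⟨max (max 0 T) (max R τ₀), by simp, by simp, by simp, by simp⟩
  -- A bound at time `τ` for the rescaled error.
  obtain ⟨C, hC⟩ := (F.rfc_interconnection_observer e hsys hrfc hP).bounded τ hτ0 (max R 0)
    (le_max_right _ _)
  obtain ⟨Y₁, hY₁0, hY₁⟩ := ContState.exists_bound (G := F.y j i)
    (F.y_smooth j i hi.le).continuousOn τ C
  obtain ⟨Y₂, hY₂0, hY₂⟩ := ContState.exists_bound (G := F.y j (i + 1))
    (F.y_smooth j (i + 1) hi).continuousOn τ C
  set K : ℝ := (Y₁ + C) * (s τ)⁻¹ ^ 3 + Y₂ * (s τ)⁻¹ with hK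
  obtain ⟨Δ, hΔ⟩ : ∃ Δ : ℝ, ∀ r ≥ Δ, K ^ 2 * Real.exp (-(c / 2 * r)) ≤ 3 / 4 := by
    have h1 : Tendsto (fun r : ℝ => K ^ 2 * Real.exp (-(c / 2 * r))) atTop (𝓝 (K ^ 2 * 0)) :=
      (Real.tendsto_exp_neg_atTop_nhds_zero.comp
        (tendsto_id.const_mul_atTop (half_pos hc))).const_mul _
    rw [mul_zero] at h1
    exact eventually_atTop.1 (h1.eventually_le_const (by norm_num))
  refine ⟨τ + max Δ 0, fun t₀ ht₀ w₀ hw₀ d hd w hw t ht₀t hτt => ?_⟩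
  have hτt' : τ ≤ t := by linarith [le_max_right Δ 0]
  have ht₀τ : t₀ ≤ τ := ht₀.2.trans hτT
  have hx : IsSolution f d t₀ w₀.1 fun r => (w r).1 := hw.fst_interconnection
  have hz : IsSolution (fun r z (_ : E q) => F.observer e P r z (h r (w r).1)) d t₀ w₀.2
    fun r => (w r).2 := hw.snd_interconnection
  have hpos : ∀ r ∈ Ici t₀, (0 : ℝ) ≤ r := fun r hr => ht₀.1.trans hr
  have hposτ : ∀ r ∈ Icc τ t, (0 : ℝ) ≤ r := fun r hr => hτ0.trans hr.1
  have hsub : Icc τ t ⊆ Ici t₀ := fun r hr => ht₀τ.trans hr.1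
  have hy : ContinuousOn (fun r => h r (w r).1) (Ici t₀) :=
    hsys.h_cont.comp_continuousOn continuousOn_id hpos hx.cont
  have hlate : ∀ r ∈ Icc τ t, ‖(w r).1‖ ≤ B ⌈r⌉₊ := by
    intro r hr
    have hrN : r ≤ ⌈r⌉₊ := Nat.le_ceil r
    have := hB ⌈r⌉₊ t₀ ⟨ht₀.1, by linarith [hr.1]⟩ w₀.1
      ((norm_fst_le w₀).trans (by linarith [hr.1])) d hd _ hx (r - t₀)
      ⟨by linarith [hr.1], by linarith [ht₀.1]⟩
    simpa using this
  have hbd : ∀ r ∈ Icc τ t, ∀ i ≤ F.m j, |F.y j i r (w r).1| ≤ ρ ⌈r⌉₊ ∧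
      |fderivWithin ℝ (fun u : ℝ × E n => F.y j i u.1 u.2) (Ici 0 ×ˢ univ) (r, (w r).1)
        (1, f r (w r).1 (d r))| ≤ ρ ⌈r⌉₊ := by
    intro r hr i hi
    have := hρ ⌈r⌉₊ i hi r ⟨hposτ r hr, Nat.le_ceil r⟩ _ (hlate r hr)
    exact ⟨this.1, this.2 _ (hd.2 r (hposτ r hr))⟩
  have hzc : AbsolutelyContinuousOnInterval (fun r => (w r).2 (e ⟨j, ⟨i, hi⟩⟩)) τ t := by
    have hκ : ContinuousOn (fun r => F.observer e P r (w r).2 (h r (w r).1)) (Ici t₀) :=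
      F.continuousOn_observer e hP continuousOn_id hpos hy hz.cont
    obtain ⟨L, hL0, hL⟩ := exists_norm_le_of_continuousOn_Ici hκ t
    have hl := hz.lipschitzOnWith (M := ⟨L, hL0⟩) hL
    refine LipschitzOnWith.absolutelyContinuousOnInterval (K := ⟨L, hL0⟩)
      (LipschitzOnWith.of_dist_le_mul fun r hr r' hr' => ?_)
    rw [uIcc_of_le hτt'] at hr hr'
    refine le_trans ?_ (hl.dist_le_mul r ⟨hsub hr, hr.2⟩ r' ⟨hsub hr', hr'.2⟩)
    rw [Real.dist_eq, dist_eq_norm]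
    exact PiLp.norm_apply_le ((w r).2 - (w r').2) _
  have hmono : ∀ {r : ℝ}, r ∈ Icc τ t → r ∈ Icc t₀ t := fun hr => ⟨hsub hr, hr.2⟩
  have hYi : ∀ i ≤ F.m j, AbsolutelyContinuousOnInterval (fun r => F.y j i r (w r).1) τ t :=
    fun i hi => hx.absolutelyContinuous_comp hsys hd ht₀.1 (F.y_smooth j i hi) ht₀τ hτt'
  have hYd : ∀ i ≤ F.m j, ∀ᵐ r, r ∈ Icc τ t → HasDerivAt (fun r => F.y j i r (w r).1)
      (fderivWithin ℝ (fun u : ℝ × E n => F.y j i u.1 u.2) (Ici 0 ×ˢ univ) (r, (w r).1)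
        (1, f r (w r).1 (d r))) r := by
    intro i hi
    filter_upwards [hx.ae_hasDerivAt_comp ht₀.1 (F.y_smooth j i hi) t] with r hr hm
    exact hr (hmono hm)
  have hest : ∀ r, F.estimate e P j (i + 1) r (h r (w r).1) (w r).2 = (s r)⁻¹ ^ 2 *
      ((F.y j i r (w r).1 - (w r).2 (e ⟨j, ⟨i, hi⟩⟩)) +
        (F.estimate e P j i r (h r (w r).1) (w r).2 - F.y j i r (w r).1)) := by
    intro r
    change P j i r * (F.estimate e P j i r (h r (w r).1) (w r).2 - F.coord e (w r).2 j i) = _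
    rw [hPs, F.coord_of_lt e _ hi]
    ring
  have key := filter_tracking hc (s := s) (a := fun r => F.a j r (h r (w r).1))
    (e := fun r => F.y j i r (w r).1 - (w r).2 (e ⟨j, ⟨i, hi⟩⟩))
    (ε := fun r => F.estimate e P j i r (h r (w r).1) (w r).2 - F.y j i r (w r).1)
    (Y := fun r => F.y j (i + 1) r (w r).1)
    (Y' := fun r => fderivWithin ℝ (fun u : ℝ × E n => F.y j (i + 1) u.1 u.2) (Ici 0 ×ˢ univ)
      (r, (w r).1) (1, f r (w r).1 (d r))) (K := K) hτt' hs hs0 (fun r _ => hs1 r)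
    (((F.a_cont j).comp_continuousOn continuousOn_id hpos hy).mono hsub)
    (fun r hr => ha r (hposτ r hr) _) (hYi (i + 1) hi) (hYd (i + 1) hi)
    ((hYi i hi.le).fun_sub hzc) ?_
    (fun r hr => hτ₀ t₀ ht₀ w₀ hw₀ d hd w hw r (hsub hr) (hττ₀.trans hr.1)) ?_ ?_
    (fun r _ => hds r) ?_ (hΔ _ (by linarith [le_max_left Δ 0]))
  · rw [← hest t] at key
    exact key
  · filter_upwards [hYd i hi.le, hz.ae_hasDerivAt t] with r h1 h2 hr
    have h2' : HasDerivAt (fun r => (w r).2 (e ⟨j, ⟨i, hi⟩⟩))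
        (F.observer e P r (w r).2 (h r (w r).1) (e ⟨j, ⟨i, hi⟩⟩)) r :=
      (EuclideanSpace.proj (e ⟨j, ⟨i, hi⟩⟩) : E M →L[ℝ] ℝ).hasFDerivAt.comp_hasDerivAt r
        (h2 (hmono hr)).2
    refine ((h1 hr).sub h2').congr_deriv ?_
    rw [F.fderivWithin_y_eq hi hc ha (hposτ r hr) (hd.2 r (hposτ r hr)), F.observer_apply,
      ← hest r]
    ring
  · refine Eventually.of_forall fun r hr => ?_
    rw [abs_mul, abs_of_pos (hs0 r)]
    exact (mul_le_mul_of_nonneg_left (hbd r hr (i + 1) hi).2 (hs0 r).le).trans (hsρ r)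
  · intro r hr
    rw [abs_mul]
    exact (mul_le_mul_of_nonneg_left (hbd r hr (i + 1) hi).1 (abs_nonneg _)).trans (hdsρ r)
  · have hwC : ‖w τ‖ ≤ C := by
      have := hC t₀ ⟨ht₀.1, ht₀τ⟩ w₀ (hw₀.trans (le_max_left _ _)) d hd w hw (τ - t₀)
        ⟨by linarith, by linarith [ht₀.1]⟩
      simpa using this
    have h1 := hY₁ τ ⟨hτ0, le_rfl⟩ (w τ).1 ((norm_fst_le _).trans hwC)
    have h2 := hY₂ τ ⟨hτ0, le_rfl⟩ (w τ).1 ((norm_fst_le _).trans hwC)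
    have h3 : |(w τ).2 (e ⟨j, ⟨i, hi⟩⟩)| ≤ C :=
      (PiLp.norm_apply_le (w τ).2 _).trans ((norm_snd_le _).trans hwC)
    have hsτ : 0 < (s τ)⁻¹ := inv_pos.2 (hs0 τ)
    refine (abs_sub _ _).trans ?_
    rw [abs_mul, abs_mul, abs_of_pos hsτ, abs_of_pos (pow_pos hsτ 3)]
    have h4 := (abs_sub (F.y j i τ (w τ).1) ((w τ).2 (e ⟨j, ⟨i, hi⟩⟩))).trans (add_le_add h1 h3)
    exact add_le_add (mul_le_mul_of_nonneg_right h4 (pow_pos hsτ 3).le)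
      (mul_le_mul_of_nonneg_right h2 hsτ.le)

/-- Accuracy of all the estimates of a chain, with the scale `S (m_j - 1 - i)` for the gain from level
`i` to level `i + 1`: the scale of the top level is chosen first, and the lower levels have to be
faster. -/
theorem uniformlyEventually_abs_estimate_sub_le (hsys : IsSystem D f h) (hrfc : RFC D f)
    {B : ℕ → ℝ} (hB : ∀ N : ℕ, ∀ t₀ ∈ Icc (0 : ℝ) N, ∀ x₀ : E n, ‖x₀‖ ≤ N →
      ∀ d ∈ Disturbances D, ∀ x, IsSolution f d t₀ x₀ x → ∀ s ∈ Icc (0 : ℝ) N, ‖x (t₀ + s)‖ ≤ B N)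
    {j : Fin F.p} {ρ : ℕ → ℝ} {c : ℝ} (hc : 0 < c) (ha : ∀ t, 0 ≤ t → ∀ v, c ≤ F.a j t v)
    (hρ : ∀ N : ℕ, ∀ i ≤ F.m j, ∀ t ∈ Icc (0 : ℝ) N, ∀ x, ‖x‖ ≤ B N → |F.y j i t x| ≤ ρ N ∧
      ∀ d ∈ D, |fderivWithin ℝ (fun u : ℝ × E n => F.y j i u.1 u.2) (Ici 0 ×ˢ univ) (t, x)
        (1, f t x d)| ≤ ρ N)
    {S : ℕ → ℝ → ℝ} (hS : ∀ k, ContDiff ℝ 1 (S k)) (hS0 : ∀ k t, 0 < S k t)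
    (hS1 : ∀ k t, S k t ≤ 1) (hSS : ∀ k t, S (k + 1) t ≤ S k t ^ 3 / 16)
    (hSρ : ∀ k t, S k t * ρ ⌈t⌉₊ ≤ c / 32) (hdS : ∀ k t, |deriv (S k) t| ≤ c / 32)
    (hdSρ : ∀ k t, |deriv (S k) t| * ρ ⌈t⌉₊ ≤ c / 32)
    {P : Fin F.p → ℕ → ℝ → ℝ} (hP : ∀ j i, Continuous (P j i))
    (hPS : ∀ i t, P j i t = (S (F.m j - 1 - i) t)⁻¹ ^ 2)
    (i : ℕ) (hi : i < F.m j) :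
    UniformlyEventually D (interconnection f h (F.observer e P)) fun t w =>
      |F.estimate e P j (i + 1) t (h t w.1) w.2 - F.y j (i + 1) t w.1|
        ≤ 2 * S (F.m j - 1 - i) t := by
  induction i with
  | zero =>
    refine F.uniformlyEventually_abs_estimate_succ_sub_le e hsys hrfc hB hc ha hρ (hS _) (hS0 _)
      (hS1 _) (hSρ _) (hdS _) (hdSρ _) hP hi (hPS 0) fun T R =>
      ⟨0, fun t₀ ht₀ w₀ _ d _ w _ t ht _ => ?_⟩
    -- `y_{0,j}` is a function of the measured output and is known exactly.
    have h0 : F.estimate e P j 0 t (h t (w t).1) (w t).2 = F.y j 0 t (w t).1 :=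
      (F.y_zero j t (ht₀.1.trans ht) _).symm
    have := hS0 (F.m j - 1 - 0) t
    beta_reduce
    rw [h0, sub_self, abs_zero]
    positivity
  | succ i ih =>
    refine F.uniformlyEventually_abs_estimate_succ_sub_le e hsys hrfc hB hc ha hρ (hS _) (hS0 _)
      (hS1 _) (hSρ _) (hdS _) (hdSρ _) hP hi (hPS (i + 1)) fun T R => ?_
    obtain ⟨τ, hτ⟩ := ih (by omega) T R
    refine ⟨τ, fun t₀ ht₀ w₀ hw₀ d hd w hw t ht ht' => ?_⟩
    refine (hτ t₀ ht₀ w₀ hw₀ d hd w hw t ht ht').trans ?_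
    have h1 := hSS (F.m j - 1 - (i + 1)) t
    rw [show F.m j - 1 - (i + 1) + 1 = F.m j - 1 - i by omega] at h1
    linarith

end OutputFamily

end Convergence

/-! ### Construction of the estimator -/

theorem UniformlyEventually.forall_finite {X U ι : Type*} [NormedAddCommGroup X] [NormedSpace ℝ X]
    [MeasurableSpace U] [Fintype ι] {D : Set U} {f : ℝ → X → U → X} {Q : ι → ℝ → X → Prop}
    (hQ : ∀ i, UniformlyEventually D f (Q i)) :
    UniformlyEventually D f fun t w => ∀ i, Q i t w := by
  intro T R
  choose τ hτ using fun i => hQ i T R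
  obtain ⟨τ', hτ'⟩ := (Finset.univ.image τ).exists_le
  exact ⟨τ', fun t₀ ht₀ w₀ hw₀ d hd w hw t ht ht' i => hτ i t₀ ht₀ w₀ hw₀ d hd w hw t ht
    ((hτ' _ (Finset.mem_image_of_mem τ (Finset.mem_univ i))).trans ht')⟩

theorem uniformlyEventually_of_KL {X U : Type*} [NormedAddCommGroup X] [NormedSpace ℝ X]
    [MeasurableSpace U] {D : Set U} {f : ℝ → X → U → X} {G : ℝ → X → ℝ} {σ : ℝ → ℝ → ℝ}
    {β : ℝ → ℝ} (hσ : KL σ) (hβ : KPlus β)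
    (hG : ∀ t₀, 0 ≤ t₀ → ∀ x₀ : X, ∀ d ∈ Disturbances D, ∀ x, IsSolution f d t₀ x₀ x →
      ∀ t, t₀ ≤ t → G t (x t) ≤ σ (β t₀ * ‖x₀‖) (t - t₀)) {ε : ℝ} (hε : 0 < ε) :
    UniformlyEventually D f fun t x => G t x ≤ ε := by
  intro T R
  obtain ⟨b, hb⟩ := isCompact_Icc.exists_bound_of_continuousOn (s := Icc 0 T)
    (hβ.cont.mono Icc_subset_Ici_self)
  have hr : 0 ≤ max b 0 * max R 0 := by positivity
  obtain ⟨τ, hτ⟩ := eventually_atTop.1 ((hσ.tendsto _ hr).eventually_le_const hε)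
  refine ⟨T + max τ 0, fun t₀ ht₀ x₀ hx₀ d hd x hx t ht ht' => ?_⟩
  have h1 : τ ≤ t - t₀ := by linarith [ht₀.2, le_max_left τ 0]
  refine (hG t₀ ht₀.1 x₀ d hd x hx t ht).trans (le_trans ?_ (hτ _ h1))
  have hβ0 : 0 ≤ β t₀ := (hβ.pos t₀ ht₀.1).le
  refine (hσ.strictMono (t - t₀) (by linarith)).monotoneOn
    (mem_Ici.2 (by positivity)) (mem_Ici.2 hr) ?_
  have h2 : β t₀ ≤ max b 0 := (le_abs_self _).trans ((hb t₀ ht₀).trans (le_max_left _ _))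
  have h3 : ‖x₀‖ ≤ max R 0 := hx₀.trans (le_max_left _ _)
  gcongr

variable {n k q l : ℕ} {D : Set (E q)} {f : ℝ → E n → E q → E n} {h : ℝ → E n → E k}

/-- Gains can be chosen so that `φ Ψ`, evaluated at the estimates, converges to its value at `𝒟y`. -/
theorem OutputFamily.exists_gains (F : OutputFamily D f h) {M : ℕ}
    (e : (Σ j : Fin F.p, Fin (F.m j)) ≃ Fin M) (hsys : IsSystem D f h) (hrfc : RFC D f)
    {Ψ : ℝ → E k → F.Space → E l} (hΨ : ContZero Ψ) {φ : ℝ → ℝ} (hφ : KPlus φ) :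
    ∃ P : Fin F.p → ℕ → ℝ → ℝ, (∀ j i, Continuous (P j i)) ∧ ∀ ε > 0,
      UniformlyEventually D (interconnection f h (F.observer e P)) fun t w =>
        φ t * ‖Ψ t (h t w.1) (F.estimates e P t (h t w.1) w.2)
          - Ψ t (h t w.1) (F.Dy t w.1)‖ ≤ ε := by
  choose B hB using fun N : ℕ => hrfc.bounded N N.cast_nonneg N N.cast_nonneg
  choose c hc ha using F.a_pos
  choose ρ hρ0 hρ using fun (j : Fin F.p) (N : ℕ) => F.exists_derivative_bound hsys N (B N) j
  choose δ hδ hδΨ using fun N : ℕ =>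
    F.exists_modulus hsys.h_cont hΨ hφ N (B N) (Nat.one_div_pos_of_nat (α := ℝ) (n := N))
  -- Small compared with the bounds `ρ j N`, and half the modulus of continuity `δ N`, since the
  -- estimates are accurate up to twice the scale.
  let ν : Fin F.p → ℕ → ℝ := fun j N =>
    min (min 1 (c j / (32 * (1 + ρ j N)))) (δ N / 2)
  have hν : ∀ j N, 0 < ν j N := fun j N => by
    have := hc j
    have := hρ0 j N
    have := hδ N
    exact lt_min (lt_min one_pos (by positivity)) (by positivity)
  choose μ hμa hμ0 hμ using fun j => exists_antitone_le_seq (ν j) (hν j)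
  choose S hS using fun j => exists_gain_hierarchy (μ j) (hμa j) (hμ0 j)
  have hμρ : ∀ j t, μ j t * (1 + ρ j ⌈t⌉₊) ≤ c j / 32 := by
    intro j t
    have h0 : 0 < 1 + ρ j ⌈t⌉₊ := by linarith [hρ0 j ⌈t⌉₊]
    rw [← le_div_iff₀ h0, div_div]
    exact (hμ j t).trans ((min_le_left _ _).trans (min_le_right _ _))
  have hsmall : ∀ j t {x : ℝ}, 0 ≤ x → x ≤ μ j t → x ≤ c j / 32 ∧ x * ρ j ⌈t⌉₊ ≤ c j / 32 := by
    intro j t x hx0 hx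
    have h0 := hρ0 j ⌈t⌉₊
    have h1 := hμρ j t
    have h2 : x * (1 + ρ j ⌈t⌉₊) ≤ c j / 32 := by
      refine le_trans ?_ h1
      gcongr
    have h3 : 0 ≤ x * ρ j ⌈t⌉₊ := mul_nonneg hx0 h0
    constructor <;> linarith
  let P : Fin F.p → ℕ → ℝ → ℝ := fun j i t => (S j (F.m j - 1 - i) t)⁻¹ ^ 2
  have hP : ∀ j i, Continuous (P j i) := fun j i =>
    ((hS j _).1.continuous.inv₀ fun t => ((hS j _).2.1 t).ne').pow 2
  refine ⟨P, hP, fun ε hε T R => ?_⟩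
  have hconv := UniformlyEventually.forall_finite
    fun c' : Σ j : Fin F.p, Fin (F.m j) =>
      F.uniformlyEventually_abs_estimate_sub_le e hsys hrfc hB (hc c'.1) (ha c'.1) (hρ c'.1)
        (fun k => (hS c'.1 k).1) (fun k => (hS c'.1 k).2.1)
        (fun k t => ((hS c'.1 k).2.2.1 t).trans
          ((hμ _ t).trans ((min_le_left _ _).trans (min_le_left _ _))))
        (fun k => (hS c'.1 k).2.2.2.2)
        (fun k t => (hsmall _ t ((hS c'.1 k).2.1 t).le ((hS c'.1 k).2.2.1 t)).2)
        (fun k t => (hsmall _ t (abs_nonneg _) ((hS c'.1 k).2.2.2.1 t)).1)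
        (fun k t => (hsmall _ t (abs_nonneg _) ((hS c'.1 k).2.2.2.1 t)).2)
        hP (fun i t => rfl) c'.2 c'.2.2
  obtain ⟨τ, hτ⟩ := hconv T R
  refine ⟨max (max τ (1 / ε)) (max T R), fun t₀ ht₀ w₀ hw₀ d hd w hw t ht ht' => ?_⟩
  simp only [max_le_iff] at ht'
  obtain ⟨⟨hτt, hεt⟩, hTt, hRt⟩ := ht'
  have ht0 : 0 ≤ t := ht₀.1.trans ht
  have htN : t ≤ ⌈t⌉₊ := Nat.le_ceil t
  have hx := hB ⌈t⌉₊ t₀ ⟨ht₀.1, by linarith⟩ w₀.1 ((norm_fst_le w₀).trans (by linarith)) d hd _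
    (IsSolution.fst_interconnection (z₀ := w₀.2) hw) (t - t₀) ⟨by linarith, by linarith [ht₀.1]⟩
  rw [add_sub_cancel] at hx
  refine (hδΨ ⌈t⌉₊ t ⟨ht0, htN⟩ _ hx _ fun c' => ?_).trans ?_
  · refine (hτ t₀ ht₀ w₀ hw₀ d hd w hw t ht hτt c').trans ?_
    have h1 := (hS c'.1 (F.m c'.1 - 1 - c'.2)).2.2.1 t
    have h2 : μ c'.1 t ≤ δ ⌈t⌉₊ / 2 := (hμ c'.1 t).trans (min_le_right _ _)
    linarith
  · rw [one_div_le (by positivity) hε]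
    linarith

/-- If `Ψ(t, h(t, x), 𝒟y(t, x))` approximates `θ(t, x)` along solutions with an error that, weighted
by `φ`, tends to zero uniformly over bounded initial data, there is a `φ`-estimator for `θ`. -/
theorem OutputFamily.hasEstimator (F : OutputFamily D f h) (hsys : IsSystem D f h)
    (hrfc : RFC D f) {θ : ℝ → E n → E l} (hθ : ContState θ) (hθ0 : ∀ t, 0 ≤ t → θ t 0 = 0)
    {Ψ : ℝ → E k → F.Space → E l} (hΨ : ContZero Ψ) {φ : ℝ → ℝ} (hφ : KPlus φ)
    (hres : ∀ ε > 0, UniformlyEventually D f fun t x =>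
      φ t * ‖Ψ t (h t x) (F.Dy t x) - θ t x‖ ≤ ε) : HasEstimator D f h θ φ := by
  obtain ⟨m, ⟨e⟩⟩ : ∃ m, Nonempty ((Σ j : Fin F.p, Fin (F.m j)) ≃ Fin m) :=
    ⟨_, ⟨Fintype.equivFin _⟩⟩
  obtain ⟨P, hP, hPε⟩ := F.exists_gains e hsys hrfc hΨ hφ
  let Ψ' : ℝ → E k → E m → E l := fun t y z => Ψ t y (F.estimates e P t y z)
  have hΨ' : ContZero Ψ' := by
    refine ⟨?_, fun t ht => ?_⟩
    · exact hΨ.cont.comp (f := fun p : ℝ × E k × E m =>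
        (p.1, p.2.1, F.estimates e P p.1 p.2.1 p.2.2))
        (continuousOn_fst.prodMk (ContinuousOn.prodMk (by fun_prop)
          (F.continuousOn_estimates e hP continuousOn_fst (fun _ ha => ha.1) (by fun_prop)
            (by fun_prop)))) (fun p hp => ⟨hp.1, mem_univ _⟩)
    · simp only [Ψ', F.estimates_zero e ht, hΨ.zero t ht]
  have hrfc' := F.rfc_interconnection_observer e hsys hrfc hP
  refine ⟨_, F.observer e P, Ψ', F.contZero_observer e hP,
    F.locLipState_observer e hsys.h_cont hP, hΨ', hrfc', ?_⟩
  let G : ℝ → E n × E m → ℝ := fun t w => φ t * ‖Ψ' t (h t w.1) w.2 - θ t w.1‖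
  have hG : ContState G := by
    have h1 : ContinuousOn (fun p : ℝ × E n × E m => h p.1 p.2.1) (Ici 0 ×ˢ univ) :=
      hsys.h_cont.comp_continuousOn continuousOn_fst (fun _ ha => ha.1) (by fun_prop)
    have h2 : ContinuousOn (fun p : ℝ × E n × E m => θ p.1 p.2.1) (Ici 0 ×ˢ univ) :=
      hθ.comp_continuousOn continuousOn_fst (fun _ ha => ha.1) (by fun_prop)
    have h3 : ContinuousOn (fun p : ℝ × E n × E m => Ψ' p.1 (h p.1 p.2.1) p.2.2)
        (Ici 0 ×ˢ univ) :=
      hΨ'.cont.comp (f := fun p : ℝ × E n × E m => (p.1, h p.1 p.2.1, p.2.2))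
        (continuousOn_fst.prodMk (h1.prodMk (by fun_prop))) (fun p hp => ⟨hp.1, mem_univ _⟩)
    exact (hφ.cont.comp continuousOn_fst fun _ hp => hp.1).mul (h3.sub h2).norm
  have hG0 : ∀ t, 0 ≤ t → G t 0 = 0 := fun t ht => by
    simp only [G, Prod.fst_zero, Prod.snd_zero, hsys.h_zero t ht, hΨ'.zero t ht, hθ0 t ht,
      sub_self, norm_zero, mul_zero]
  have hatt : ∀ ε > 0, UniformlyEventually D (interconnection f h (F.observer e P))
      fun t w => G t w ≤ ε := by
    intro ε hε T R
    obtain ⟨τ₁, h₁⟩ := hPε (ε / 2) (half_pos hε) T R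
    obtain ⟨τ₂, h₂⟩ := hres (ε / 2) (half_pos hε) T R
    refine ⟨max τ₁ τ₂, fun t₀ ht₀ w₀ hw₀ d hd w hw t ht ht' => ?_⟩
    have e₁ := h₁ t₀ ht₀ w₀ hw₀ d hd w hw t ht ((le_max_left _ _).trans ht')
    have e₂ := h₂ t₀ ht₀ w₀.1 ((norm_fst_le w₀).trans hw₀) d hd _
      (IsSolution.fst_interconnection (z₀ := w₀.2) hw) t ht ((le_max_right _ _).trans ht')
    have hφ0 := (hφ.pos t (ht₀.1.trans ht)).le
    calc G t (w t) ≤ φ t * (‖Ψ t (h t (w t).1) (F.estimates e P t (h t (w t).1) (w t).2)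
          - Ψ t (h t (w t).1) (F.Dy t (w t).1)‖
          + ‖Ψ t (h t (w t).1) (F.Dy t (w t).1) - θ t (w t).1‖) :=
          mul_le_mul_of_nonneg_left (norm_sub_le_norm_sub_add_norm_sub _ _ _) hφ0
      _ ≤ ε := by linarith
  obtain ⟨σ, β, hσ, hβ, hest⟩ := hrfc'.exists_KL_estimate
    (F.exists_linear_bound_interconnection e hsys hP) hG hG0 hatt
    (N := fun w => Real.sqrt (‖w.1‖ ^ 2 + ‖w.2‖ ^ 2)) (fun w => by
      rw [Prod.norm_def]
      refine max_le (Real.le_sqrt_of_sq_le ?_) (Real.le_sqrt_of_sq_le ?_)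
      · linarith [sq_nonneg ‖w.2‖]
      · linarith [sq_nonneg ‖w.1‖])
  exact ⟨σ, β, hσ, hβ, fun t₀ ht₀ x₀ z₀ d hd w hw t ht =>
    hest t₀ ht₀ (x₀, z₀) d hd w hw t ht⟩

end Estimator

theorem theorem3p1 {n k q l : ℕ} (D : Set (Estimator.E q))
    (f : ℝ → Estimator.E n → Estimator.E q → Estimator.E n)
    (h : ℝ → Estimator.E n → Estimator.E k)
    (hsys : Estimator.IsSystem D f h) (hrfc : Estimator.RFC D f)
    (θ : ℝ → Estimator.E n → Estimator.E l)
    (hθ : Estimator.ContState θ) (hθ0 : ∀ t, 0 ≤ t → θ t 0 = 0) :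
    (Estimator.RobustlyCompletelyObservable D f h θ →
        ∀ φ : ℝ → ℝ, Estimator.KPlus φ → Estimator.HasEstimator D f h θ φ) ∧
      (Estimator.RobustlyCompletelyDetectable D f h θ →
        Estimator.HasEstimator D f h θ (fun _ => 1)) := by
  constructor
  · rintro ⟨F, Ψ, hΨ, heq⟩ φ hφ
    refine F.hasEstimator hsys hrfc hθ hθ0 hΨ hφ fun ε hε T R =>
      ⟨0, fun t₀ ht₀ x₀ _ d _ x _ t ht _ => ?_⟩
    beta_reduce
    rw [← heq t (ht₀.1.trans ht) (x t), sub_self, norm_zero, mul_zero]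
    exact hε.le
  · rintro ⟨F, Ψ, hΨ, σ, β, hσ, hβ, hres⟩
    refine F.hasEstimator hsys hrfc hθ hθ0 hΨ ⟨continuousOn_const, fun _ _ => one_pos⟩
      fun ε hε => Estimator.uniformlyEventually_of_KL hσ hβ
        (fun t₀ ht₀ x₀ d hd x hx t ht => ?_) hε
    rw [one_mul, norm_sub_rev]
    exact hres t₀ ht₀ x₀ d hd x hx t ht
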